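/- Let $n,m$ be numbers of components, let $0<\lambda_1\le\dots\le\lambda_n$ and $0<\mu_1<\dots<\mu_m$, $\Lambda^+=\mathrm{diag}(\lambda_1,\dots,\lambda_n)$, $\Lambda^-=\mathrm{diag}(\mu_1,\dots,\mu_m)$. Let $\Sigma^{++}\in\mathbb R^{n\times n}$ and $\Sigma^{+-},Q_0\in\mathbb R^{n\times m}$ be constant matrices, let $C^+$ and $C^-$ be $L^\infty$ functions on the triangle $\{(x,\xi):0\le\xi\le x\le1\}$ with values in $\mathbb R^{n\times n}$ and $\mathbb R^{n\times m}$, and let $\Omega\in L^\infty((0,1);\mathbb R^{m\times m})$ be upper triangular almost everywhere. Consider on $t\ge 0$, $x\in[0,1]$ the system $$\alpha_t(t,x)+\Lambda^+\alpha_x(t,x)=\Sigma^{++}\alpha(t,x)+\Sigma^{+-}\beta(t,x)+\int_0^xC^+(x,\xi)\alpha(t,\xi)\,d\xi+\int_0^xC^-(x,\xi)\beta(t,\xi)\,d\xi,$$ $$\beta_t(t,x)-\Lambda^-\beta_x(t,x)=\Omega(x)\beta(t,x),$$ with boundary conditions $\alpha(t,0)=Q_0\beta(t,0)$, $\beta(t,1)=0$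 and initial condition $(\alpha,\beta)(0,\cdot)=(\alpha^0,\beta^0)$. A weak solution is a pair $(\alpha,\beta)\in C([0,\infty);L^2([0,1];\mathbb R^n\times\mathbb R^m))$ such that for every $T\ge0$ and all $C^1$ test functions $\varphi,\psi$ with values in $\mathbb R^n,\mathbb R^m$ that satisfy $\varphi(t,1)=0$ and $\Lambda^-\psi(t,0)=Q_0^T\Lambda^+\varphi(t,0)$ for $t\in[0,T]$, $$\int_0^1(\alpha\cdot\varphi+\beta\cdot\psi)(T,x)\,dx=\int_0^1\big(\alpha^0(x)\cdot\varphi(0,x)+\beta^0(x)\cdot\psi(0,x)\big)dx+\int_0^T\!\!\int_0^1\big(\alpha\cdot(\varphi_t+\Lambda^+\varphi_x)+\beta\cdot(\psi_t-\Lambda^-\psi_x)+F\cdot\varphi+(\Omega\beta)\cdot\psi\big)dx\,dt,$$ where $F$ is the right-hand side of the $\alpha$-equation. Then the zero equilibrium is exponentially stable in the $L^2$ sense: there are constants $K,\kappa>0$, depending only on the data of the system, such that for all initial data $(\alpha^0,\beta^0)\in L^2([0,1];\mathbb R^n\times\mathbb R^m)$ the system has a weak solution, and every weak solution satisfies $$\|(\alpha,\beta)(t,\cdot)\|_{L^2}\le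 K e^{-\kappa t}\,\|(\alpha^0,\beta^0)\|_{L^2}\qquad\text{for all }t\ge0.$$ -/

import Mathlib

open MeasureTheory
open scoped Matrix

noncomputable section

namespace HyperbolicTarget

/-- The triangle `{0 ≤ ξ ≤ x ≤ 1}`, with points written `(x, ξ)`. -/
def triangle : Set (ℝ × ℝ) := {p | 0 ≤ p.2 ∧ p.2 ≤ p.1 ∧ p.1 ≤ 1}

/-- `L²([0,1]; ℝᵏ)`, where `ℝᵏ` carries the Euclidean norm. -/
abbrev L2 (k : ℕ) : Type :=
  Lp (EuclideanSpace ℝ (Fin k)) 2 (volume.restrict (Set.Icc (0 : ℝ) 1))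

/-- The `L²([0,1]; ℝⁿ × ℝᵐ)` norm of a pair `(a, b)`. -/
def l2Norm {n m : ℕ} (a : L2 n) (b : L2 m) : ℝ := Real.sqrt (‖a‖ ^ 2 + ‖b‖ ^ 2)

/-- The data of the target system
`α_t + Λ⁺ α_x = Σ⁺⁺ α + Σ⁺⁻ β + ∫₀ˣ C⁺(x,ξ) α(t,ξ) dξ + ∫₀ˣ C⁻(x,ξ) β(t,ξ) dξ`,
`β_t - Λ⁻ β_x = Ω(x) β`, `α(t,0) = Q₀ β(t,0)`, `β(t,1) = 0` on `[0,1]`,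
where `Λ⁺ = diag(λ₁,…,λₙ)`, `Λ⁻ = diag(μ₁,…,μₘ)` and
`-μₘ < ⋯ < -μ₁ < 0 < λ₁ ≤ ⋯ ≤ λₙ`. -/
structure TargetSystem (n m : ℕ) where
  lam : Fin n → ℝ
  mu : Fin m → ℝ
  lam_pos : ∀ i, 0 < lam i
  lam_mono : Monotone lam
  mu_pos : ∀ i, 0 < mu i
  mu_strictMono : StrictMono mu
  Spp : Matrix (Fin n) (Fin n) ℝ
  Spm : Matrix (Fin n) (Fin m) ℝ
  Q0 : Matrix (Fin n) (Fin m) ℝ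
  Cp : ℝ → ℝ → Matrix (Fin n) (Fin n) ℝ
  Cm : ℝ → ℝ → Matrix (Fin n) (Fin m) ℝ
  Om : ℝ → Matrix (Fin m) (Fin m) ℝ
  Cp_bdd : ∀ i j, MemLp (fun p : ℝ × ℝ => Cp p.1 p.2 i j) ⊤ (volume.restrict triangle)
  Cm_bdd : ∀ i j, MemLp (fun p : ℝ × ℝ => Cm p.1 p.2 i j) ⊤ (volume.restrict triangle)
  Om_bdd : ∀ i j, MemLp (fun x : ℝ => Om x i j) ⊤ (volume.restrict (Set.Icc (0 : ℝ) 1))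
  Om_upper : ∀ᵐ x ∂(volume.restrict (Set.Icc (0 : ℝ) 1)), ∀ i j, j < i → Om x i j = 0

namespace TargetSystem

variable {n m : ℕ} (S : TargetSystem n m)

/-- `Λ⁺ = diag(λ₁,…,λₙ)`. -/
def LamP : Matrix (Fin n) (Fin n) ℝ := Matrix.diagonal S.lam

/-- `Λ⁻ = diag(μ₁,…,μₘ)`. -/
def LamM : Matrix (Fin m) (Fin m) ℝ := Matrix.diagonal S.mu

/-- The right-hand side of the `α`-equation at a fixed time, for the profiles `a`, `b`. -/
def source (a : ℝ → Fin n → ℝ) (b : ℝ → Fin m → ℝ) (x : ℝ) : Fin n → ℝ :=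
  S.Spp *ᵥ a x + S.Spm *ᵥ b x
    + (∫ ξ in (0 : ℝ)..x, S.Cp x ξ *ᵥ a ξ) + (∫ ξ in (0 : ℝ)..x, S.Cm x ξ *ᵥ b ξ)

/-- Admissible test functions `(φ, ψ)(t, x)` on `[0,T] × [0,1]`: (restrictions of) `C¹` functions
that satisfy the adjoint boundary conditions `φ(t,1) = 0` and `Λ⁻ ψ(t,0) = Q₀ᵀ Λ⁺ φ(t,0)`. -/
structure IsTest (T : ℝ) (φ : ℝ → ℝ → Fin n → ℝ) (ψ : ℝ → ℝ → Fin m → ℝ) : Prop where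
  contDiff_left : ContDiff ℝ 1 (Function.uncurry φ)
  contDiff_right : ContDiff ℝ 1 (Function.uncurry ψ)
  at_one : ∀ t ∈ Set.Icc 0 T, φ t 1 = 0
  at_zero : ∀ t ∈ Set.Icc 0 T, S.LamM *ᵥ ψ t 0 = S.Q0ᵀ *ᵥ (S.LamP *ᵥ φ t 0)

/-- `(α, β)`, continuous from `[0,∞)` to `L²`, is a weak solution of the target system with initial
data `(α⁰, β⁰) ∈ L²`: for every `T ≥ 0` and every admissible test pair, the identity obtained from
the equations, the boundary conditions and the initial condition by integration by parts over
`[0,T] × [0,1]` holds. -/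
structure IsWeakSolution (α₀ : L2 n) (β₀ : L2 m) (α : ℝ → L2 n) (β : ℝ → L2 m) : Prop where
  continuousOn_left : ContinuousOn α (Set.Ici 0)
  continuousOn_right : ContinuousOn β (Set.Ici 0)
  identity : ∀ T : ℝ, 0 ≤ T → ∀ (φ : ℝ → ℝ → Fin n → ℝ) (ψ : ℝ → ℝ → Fin m → ℝ), S.IsTest T φ ψ →
    (∫ x in (0 : ℝ)..1, ((α T x).ofLp ⬝ᵥ φ T x + (β T x).ofLp ⬝ᵥ ψ T x))
      = (∫ x in (0 : ℝ)..1, ((α₀ x).ofLp ⬝ᵥ φ 0 x + (β₀ x).ofLp ⬝ᵥ ψ 0 x))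
        + ∫ t in (0 : ℝ)..T, ∫ x in (0 : ℝ)..1,
            ((α t x).ofLp ⬝ᵥ
                (deriv (fun s => φ s x) t + S.LamP *ᵥ deriv (fun y => φ t y) x)
              + (β t x).ofLp ⬝ᵥ
                (deriv (fun s => ψ s x) t - S.LamM *ᵥ deriv (fun y => ψ t y) x)
              + S.source (fun y => (α t y).ofLp) (fun y => (β t y).ofLp) x ⬝ᵥ φ t x
              + (S.Om x *ᵥ (β t x).ofLp) ⬝ᵥ ψ t x)

end TargetSystem

end HyperbolicTarget

end

/-!
The system is a bounded perturbation `B` (the right-hand sides) of a transport problem that is solved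
explicitly along characteristics by operators `S(t)` (`transport`). Both halves of the theorem go
through Duhamel's formula `w(t) = S(t) w₀ + ∫₀ᵗ S(t-s) B w(s) ds`: weak solutions and its continuous
solutions are the same.

*Decay.* Weigh `α` by `e^{-νx}` and `β` by `e^{νx}`, so that every weight decreases in the direction
of transport. In the weighted norm `S(t)` decays like `e^{-νct}`, where `c` is a lower bound for the
speeds, up to a factor that does not depend on `ν` (`norm_weightOp_transport_le`). The norm of `B` is
bounded uniformly in `ν ≥ 0` (`exists_sourceOp`): the coupling of `α` to `α` and `β` is of Volterra
type, with integrals over `ξ ≤ x`, where the weights are at least `e^{-νx}`, and `β` is only coupled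
to `β` at the same point. Taking `ν` large, the transport wins (`mild_decay`); any rate `κ` can be
reached.

*Existence.* `exists_mild` solves Duhamel's formula by Picard iteration. That solutions are weak
solutions is checked for `S(t) w₀` with `w₀` made of `C¹` functions supported in `(0,1)`, by the
divergence theorem along characteristics (`integral_transport`, `boundary_terms_cancel`); density of
such data (`transport_weak`) and Fubini's theorem (`weak_of_duhamel`) give the general case.

*Uniqueness.* For a weak solution `w` the difference `d` of both sides of Duhamel's formula is a weak
solution of the free transport with zero data. The adjoint transport problem has explicit `C¹`
solutions with arbitrary final values supported in `(0,1)`, which are admissible test functions, so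
`d(T)` is orthogonal to a dense set (`eq_zero_of_weak`).
-/

noncomputable section

namespace HyperbolicTarget

open Set Filter Topology

/-! ### Scalar square integrable functions on the unit interval -/

/-- Lebesgue measure on `[0,1]`, as a measure on `ℝ`. -/
abbrev unitVol : Measure ℝ := volume.restrict (Icc (0 : ℝ) 1)

/-- Scalar `L²([0,1])`. -/
abbrev L2s : Type := Lp ℝ 2 unitVol

instance : IsProbabilityMeasure unitVol := ⟨by simp⟩

/-- The class in `L²([0,1])` of a function on the line (`0` if it is not square integrable). -/
@[irreducible]
def toL2s (f : ℝ → ℝ) : L2s := by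
  classical exact if h : MemLp f 2 unitVol then h.toLp f else 0

theorem coeFn_toL2s {f : ℝ → ℝ} (h : MemLp f 2 unitVol) : toL2s f =ᵐ[unitVol] f := by
  rw [toL2s, dif_pos h]; exact h.coeFn_toLp

theorem memLp_of_continuous {f : ℝ → ℝ} (h : Continuous f) : MemLp f 2 unitVol := by
  obtain ⟨C, hC⟩ := isCompact_Icc.exists_bound_of_continuousOn (s := Icc (0 : ℝ) 1) h.continuousOn
  exact MemLp.of_bound h.aestronglyMeasurable C
    ((ae_restrict_iff' measurableSet_Icc).2 (Eventually.of_forall hC))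

theorem coeFn_toL2s_of_continuous {f : ℝ → ℝ} (h : Continuous f) : toL2s f =ᵐ[unitVol] f :=
  coeFn_toL2s (memLp_of_continuous h)

theorem integral_unitVol (f : ℝ → ℝ) : ∫ x, f x ∂unitVol = ∫ x in (0 : ℝ)..1, f x := by
  rw [intervalIntegral.integral_of_le zero_le_one, integral_Icc_eq_integral_Ioc]

theorem inner_toL2s (a : L2s) {f : ℝ → ℝ} (hf : Continuous f) :
    inner ℝ a (toL2s f) = ∫ x in (0 : ℝ)..1, a x * f x := by
  rw [L2.inner_def, ← integral_unitVol]
  refine integral_congr_ae ?_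
  filter_upwards [coeFn_toL2s_of_continuous hf] with x hx
  simp [hx, mul_comm]

theorem inner_toL2s_toL2s {f g : ℝ → ℝ} (hf : Continuous f) (hg : Continuous g) :
    inner ℝ (toL2s f) (toL2s g) = ∫ x in (0 : ℝ)..1, f x * g x := by
  rw [inner_toL2s _ hg, ← integral_unitVol, ← integral_unitVol]
  refine integral_congr_ae ?_
  filter_upwards [coeFn_toL2s_of_continuous hf] with x hx
  simp [hx]

theorem toL2s_congr {f g : ℝ → ℝ} (hf : Continuous f) (hg : Continuous g)
    (h : ∀ x ∈ Icc (0 : ℝ) 1, f x = g x) : toL2s f = toL2s g := by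
  refine Lp.ext ?_
  filter_upwards [coeFn_toL2s_of_continuous hf, coeFn_toL2s_of_continuous hg,
    ae_restrict_mem measurableSet_Icc] with x h1 h2 h3
  rw [h1, h2, h x h3]

theorem norm_sub_sq_toL2s {f g : ℝ → ℝ} (hf : Continuous f) (hg : Continuous g) :
    ‖toL2s f - toL2s g‖ ^ 2 = ∫ x in (0 : ℝ)..1, (f x - g x) ^ 2 := by
  rw [← real_inner_self_eq_norm_sq, L2.inner_def, ← integral_unitVol]
  refine integral_congr_ae ?_
  filter_upwards [coeFn_toL2s_of_continuous hf, coeFn_toL2s_of_continuous hg,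
    Lp.coeFn_sub (toL2s f) (toL2s g)] with x h1 h2 h3
  rw [h3, Pi.sub_apply, h1, h2]
  simp [sq]

/-- A jointly continuous function of `(t, x)` is a continuous curve in `L²([0,1])`. -/
theorem continuous_toL2s {Y : Type*} [TopologicalSpace Y] [FirstCountableTopology Y]
    {F : Y → ℝ → ℝ} (hF : Continuous (Function.uncurry F)) :
    Continuous fun t => toL2s (F t) := by
  have hc : ∀ t, Continuous (F t) := fun t => by
    exact hF.comp (Continuous.prodMk continuous_const continuous_id)
  refine continuous_iff_continuousAt.2 fun t₀ => ?_
  rw [ContinuousAt, tendsto_iff_norm_sub_tendsto_zero]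
  have h1 : Continuous fun t => ∫ x in (0 : ℝ)..1, (F t x - F t₀ x) ^ 2 := by
    apply intervalIntegral.continuous_parametric_intervalIntegral_of_continuous'
    have h2 : Continuous fun p : Y × ℝ => F t₀ p.2 := (hc t₀).comp continuous_snd
    exact (hF.sub h2).pow 2
  have h2 := (h1.tendsto t₀).sqrt
  simp only [sub_self, ne_eq, OfNat.ofNat_ne_zero, not_false_eq_true, zero_pow,
    intervalIntegral.integral_zero, Real.sqrt_zero] at h2
  refine h2.congr fun t => ?_
  rw [← norm_sub_sq_toL2s (hc t) (hc t₀), Real.sqrt_sq (norm_nonneg _)]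

/-- Bounded operators on `L²([0,1])` from maps that are additive and homogeneous almost everywhere:
`T f` need only be a function, square integrable with the right bound. -/
theorem exists_op (T : L2s → ℝ → ℝ) (C : ℝ) (hmem : ∀ f, MemLp (T f) 2 unitVol)
    (hadd : ∀ f g, T (f + g) =ᵐ[unitVol] T f + T g)
    (hsmul : ∀ (c : ℝ) f, T (c • f) =ᵐ[unitVol] c • T f)
    (hbound : ∀ f, ‖(hmem f).toLp (T f)‖ ≤ C * ‖f‖) :
    ∃ L : L2s →L[ℝ] L2s, (∀ f, L f =ᵐ[unitVol] T f) ∧ ∀ f, ‖L f‖ ≤ C * ‖f‖ := by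
  let L₀ : L2s →ₗ[ℝ] L2s :=
    { toFun := fun f => (hmem f).toLp (T f)
      map_add' := fun f g => by
        rw [← MemLp.toLp_add]; exact (MemLp.toLp_eq_toLp_iff _ _).2 (hadd f g)
      map_smul' := fun c f => by
        rw [RingHom.id_apply, ← MemLp.toLp_const_smul]
        exact (MemLp.toLp_eq_toLp_iff _ _).2 (hsmul c f) }
  exact ⟨L₀.mkContinuous C hbound, fun f => (hmem f).coeFn_toLp, hbound⟩

/-! ### Multiplication operators -/

theorem exists_mulOp {w : ℝ → ℝ} (hw : MemLp w ⊤ unitVol) :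
    ∃ L : L2s →L[ℝ] L2s, ∀ f, L f =ᵐ[unitVol] fun x => w x * f x := by
  have hmem : ∀ f : L2s, MemLp (fun x => w x * f x) 2 unitVol := fun f =>
    (Lp.memLp f).mul hw
  obtain ⟨C, hC0, hC⟩ : ∃ C : ℝ, 0 ≤ C ∧ ∀ᵐ x ∂unitVol, ‖w x‖ ≤ C := by
    refine ⟨(eLpNorm w ⊤ unitVol).toReal, ENNReal.toReal_nonneg, ?_⟩
    filter_upwards [ae_le_eLpNormEssSup (f := w) (μ := unitVol)] with x hx
    rw [← eLpNorm_exponent_top] at hx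
    rw [← toReal_enorm]
    exact ENNReal.toReal_mono hw.2.ne hx
  obtain ⟨L, hL, -⟩ := exists_op (fun f x => w x * f x) C hmem
    (fun f g => by
      filter_upwards [Lp.coeFn_add f g] with x hx
      rw [hx, Pi.add_apply, Pi.add_apply, mul_add])
    (fun c f => by
      filter_upwards [Lp.coeFn_smul c f] with x hx
      rw [hx, Pi.smul_apply, Pi.smul_apply, mul_smul_comm])
    (fun f => by
      refine Lp.norm_le_mul_norm_of_ae_le_mul ?_
      filter_upwards [(hmem f).coeFn_toLp, hC] with x hx h2
      rw [hx, norm_mul]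
      gcongr)
  exact ⟨L, hL⟩

theorem memLp_top_of_continuous {f : ℝ → ℝ} (h : Continuous f) : MemLp f ⊤ unitVol := by
  obtain ⟨C, hC⟩ := isCompact_Icc.exists_bound_of_continuousOn (s := Icc (0 : ℝ) 1) h.continuousOn
  exact MemLp.of_bound h.aestronglyMeasurable C
    ((ae_restrict_iff' measurableSet_Icc).2 (Eventually.of_forall hC))

/-- Multiplication by an essentially bounded function (`0` if it is not). -/
@[irreducible]
def mulOp (w : ℝ → ℝ) : L2s →L[ℝ] L2s := by
  classical exact if h : MemLp w ⊤ unitVol then (exists_mulOp h).choose else 0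

theorem mulOp_ae {w : ℝ → ℝ} (hw : MemLp w ⊤ unitVol) (f : L2s) :
    mulOp w f =ᵐ[unitVol] fun x => w x * f x := by
  rw [mulOp, dif_pos hw]; exact (exists_mulOp hw).choose_spec f

/-! ### Affine pull-backs -/

/-- The extension by zero of a function on `[0,1]`. -/
abbrev zext (f : ℝ → ℝ) : ℝ → ℝ := (Icc (0 : ℝ) 1).indicator f

theorem map_affine {p : ℝ} (hp : p ≠ 0) (s : ℝ) :
    Measure.map (fun x : ℝ => p * (x - s)) volume = ENNReal.ofReal |p⁻¹| • volume := by
  have h : (fun x : ℝ => p * (x - s)) = (fun x => p * x) ∘ fun x => x - s := rfl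
  rw [h, ← Measure.map_map (by fun_prop) (by fun_prop), map_sub_right_eq_self,
    Real.map_volume_mul_left hp]

theorem quasiMeasurePreserving_affine {p : ℝ} (hp : p ≠ 0) (s : ℝ) :
    Measure.QuasiMeasurePreserving (fun x : ℝ => p * (x - s)) volume volume := by
  refine ⟨by fun_prop, ?_⟩
  rw [map_affine hp]
  exact Measure.smul_absolutelyContinuous

theorem zext_affine_congr {p : ℝ} (hp : p ≠ 0) (s : ℝ) {f g : ℝ → ℝ} (h : f =ᵐ[unitVol] g) :
    (fun x => zext f (p * (x - s))) =ᵐ[unitVol] fun x => zext g (p * (x - s)) := by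
  have h1 : zext f =ᵐ[volume] zext g := by
    rw [Filter.EventuallyEq, ae_restrict_iff' measurableSet_Icc] at h
    filter_upwards [h] with x hx
    by_cases hxI : x ∈ Icc (0 : ℝ) 1
    · simp [zext, hxI, hx hxI]
    · simp only [zext, indicator_of_notMem hxI]
  exact ae_restrict_of_ae ((quasiMeasurePreserving_affine hp s).ae_eq_comp h1)

theorem eLpNorm_zext_affine_le {p : ℝ} (hp : p ≠ 0) (s : ℝ) {f : ℝ → ℝ}
    (hf : AEStronglyMeasurable f unitVol) :
    eLpNorm (fun x => zext f (p * (x - s))) 2 unitVol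
      ≤ ENNReal.ofReal (|p⁻¹| ^ (1 / 2 : ℝ)) * eLpNorm f 2 unitVol := by
  have hz : AEStronglyMeasurable (zext f) volume :=
    (aestronglyMeasurable_indicator_iff measurableSet_Icc).2 hf
  have hz' : AEStronglyMeasurable (zext f) (Measure.map (fun x : ℝ => p * (x - s)) volume) :=
    hz.mono_ac (quasiMeasurePreserving_affine hp s).absolutelyContinuous
  calc eLpNorm (fun x => zext f (p * (x - s))) 2 unitVol
      ≤ eLpNorm (zext f ∘ fun x => p * (x - s)) 2 volume := eLpNorm_restrict_le _ _ _ _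
    _ = ENNReal.ofReal (|p⁻¹| ^ (1 / 2 : ℝ)) * eLpNorm (zext f) 2 volume := by
        rw [← eLpNorm_map_measure hz' (by fun_prop), map_affine hp,
          eLpNorm_smul_measure_of_ne_zero (by simpa using hp), smul_eq_mul,
          ENNReal.ofReal_rpow_of_nonneg (abs_nonneg _) (by norm_num)]
        norm_num
    _ = _ := by rw [eLpNorm_indicator_eq_eLpNorm_restrict measurableSet_Icc]

theorem exists_pullback {p : ℝ} (hp : p ≠ 0) (s : ℝ) :
    ∃ L : L2s →L[ℝ] L2s, (∀ f, L f =ᵐ[unitVol] fun x => zext f (p * (x - s))) ∧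
      ∀ f, ‖L f‖ ≤ |p⁻¹| ^ (1 / 2 : ℝ) * ‖f‖ := by
  have hmem : ∀ f : L2s, MemLp (fun x => zext f (p * (x - s))) 2 unitVol := fun f => by
    have hz : AEStronglyMeasurable (zext f) volume :=
      (aestronglyMeasurable_indicator_iff measurableSet_Icc).2 (Lp.memLp f).1
    refine ⟨(hz.comp_quasiMeasurePreserving (quasiMeasurePreserving_affine hp s)).restrict, ?_⟩
    exact (eLpNorm_zext_affine_le hp s (Lp.memLp f).1).trans_lt
      (ENNReal.mul_lt_top ENNReal.ofReal_lt_top (Lp.memLp f).2)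
  refine exists_op (fun f x => zext f (p * (x - s))) _ hmem
    (fun f g => (zext_affine_congr hp s (Lp.coeFn_add f g)).trans ?_)
    (fun c f => (zext_affine_congr hp s (Lp.coeFn_smul c f)).trans ?_) fun f => ?_
  · exact Eventually.of_forall fun x => by simp [zext, indicator_add']
  · exact Eventually.of_forall fun x => by simp [zext, indicator_apply]
  · rw [Lp.norm_toLp, Lp.norm_def]
    have h := ENNReal.toReal_mono
      (ENNReal.mul_lt_top ENNReal.ofReal_lt_top (Lp.memLp f).2).ne
      (eLpNorm_zext_affine_le hp s (Lp.memLp f).1)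
    rwa [ENNReal.toReal_mul, ENNReal.toReal_ofReal (by positivity)] at h

/-- The operator `f ↦ (x ↦ f (p (x - s)))` on `L²([0,1])`, with `f` extended by zero outside `[0,1]`
(and the zero operator if `p = 0`). -/
@[irreducible]
def pullback (p s : ℝ) : L2s →L[ℝ] L2s := by
  classical exact if h : p ≠ 0 then (exists_pullback h s).choose else 0

theorem pullback_ae {p : ℝ} (hp : p ≠ 0) (s : ℝ) (f : L2s) :
    pullback p s f =ᵐ[unitVol] fun x => zext f (p * (x - s)) := by
  rw [pullback, dif_pos hp]; exact (exists_pullback hp s).choose_spec.1 f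

theorem norm_pullback_le (p s : ℝ) (f : L2s) :
    ‖pullback p s f‖ ≤ |p⁻¹| ^ (1 / 2 : ℝ) * ‖f‖ := by
  by_cases hp : p ≠ 0
  · rw [pullback, dif_pos hp]; exact (exists_pullback hp s).choose_spec.2 f
  · rw [pullback, dif_neg hp]; simp; positivity

/-- A pull-back inherits a pointwise comparison of weights along the affine map. -/
theorem norm_mulOp_pullback_le {p s θ : ℝ} (hp : p ≠ 0) (hθ : 0 ≤ θ) {w₁ w₂ : ℝ → ℝ}
    (h₁ : MemLp w₁ ⊤ unitVol) (h₂ : MemLp w₂ ⊤ unitVol)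
    (h : ∀ x ∈ Icc (0 : ℝ) 1, p * (x - s) ∈ Icc (0 : ℝ) 1 → |w₁ x| ≤ θ * |w₂ (p * (x - s))|)
    (f : L2s) :
    ‖mulOp w₁ (pullback p s f)‖ ≤ θ * (|p⁻¹| ^ (1 / 2 : ℝ) * ‖mulOp w₂ f‖) := by
  refine (Lp.norm_le_mul_norm_of_ae_le_mul (g := pullback p s (mulOp w₂ f)) (c := θ) ?_).trans
    (by gcongr; exact norm_pullback_le _ _ _)
  filter_upwards [mulOp_ae h₁ (pullback p s f), pullback_ae hp s f,
    pullback_ae hp s (mulOp w₂ f), zext_affine_congr hp s (mulOp_ae h₂ f),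
    ae_restrict_mem measurableSet_Icc] with x h1 h2 h3 h4 h5
  rw [h1, h2, h3, h4]
  by_cases hx : p * (x - s) ∈ Icc (0 : ℝ) 1
  · simp only [zext, indicator_of_mem hx, norm_mul, Real.norm_eq_abs]
    rw [← mul_assoc]
    gcongr
    exact h x h5 hx
  · simp only [zext, indicator_of_notMem hx]; simp

/-! ### Density of interior test functions and strong continuity of translations -/

/-- `C¹` functions on the line that vanish outside `(0,1)`. -/
def IsBump (g : ℝ → ℝ) : Prop := ContDiff ℝ 1 g ∧ ∀ x, x ∉ Ioo (0 : ℝ) 1 → g x = 0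

theorem IsBump.continuous {g : ℝ → ℝ} (h : IsBump g) : Continuous g := h.1.continuous

theorem isBump_zero : IsBump fun _ => 0 := ⟨contDiff_const, fun _ _ => rfl⟩

theorem eq_zero_of_inner_bump {f : L2s} (h : ∀ g, IsBump g → inner ℝ f (toL2s g) = 0) : f = 0 := by
  have hint : Integrable f unitVol := (Lp.memLp f).integrable (by norm_num)
  have h1 : ∀ᵐ x ∂volume, x ∈ Ioo (0 : ℝ) 1 → f x = 0 := by
    refine isOpen_Ioo.ae_eq_zero_of_integral_contDiff_smul_eq_zero
      (IntegrableOn.locallyIntegrableOn (hint.mono_measure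
        (Measure.restrict_mono Ioo_subset_Icc_self le_rfl))) fun g hg _ hgt => ?_
    have hz : ∀ x, x ∉ Ioo (0 : ℝ) 1 → g x = 0 := fun x hx =>
      image_eq_zero_of_notMem_tsupport fun hx' => hx (hgt hx')
    have h2 := h g ⟨hg.of_le (by simp), hz⟩
    rw [inner_toL2s _ hg.continuous, ← integral_unitVol] at h2
    rw [← h2, ← setIntegral_eq_integral_of_forall_compl_eq_zero (s := Icc (0 : ℝ) 1)]
    · simp [mul_comm]
    · intro x hx
      rw [hz x fun hx' => hx (Ioo_subset_Icc_self hx'), zero_smul]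
  refine Lp.ext ?_
  have h3 : ∀ᵐ x ∂unitVol, x ∈ Ioo (0 : ℝ) 1 → f x = 0 := ae_restrict_of_ae h1
  have h4 : ∀ᵐ x ∂unitVol, x ∈ Ioo (0 : ℝ) 1 := by
    rw [unitVol, ← restrict_Ioo_eq_restrict_Icc]
    exact ae_restrict_mem measurableSet_Ioo
  filter_upwards [h3, h4, Lp.coeFn_zero ℝ 2 unitVol] with x h5 h6 h7
  rw [h5 h6, h7]; rfl

theorem dense_bump : Dense {f : L2s | ∃ g, IsBump g ∧ f = toL2s g} := by
  let D : Submodule ℝ L2s :=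
    { carrier := {f : L2s | ∃ g, IsBump g ∧ f = toL2s g}
      add_mem' := by
        rintro _ _ ⟨g, hg, rfl⟩ ⟨h, hh, rfl⟩
        refine ⟨fun x => g x + h x, ⟨hg.1.add hh.1, fun x hx => by simp [hg.2 x hx, hh.2 x hx]⟩,
          Lp.ext ?_⟩
        filter_upwards [Lp.coeFn_add (toL2s g) (toL2s h), coeFn_toL2s_of_continuous hg.continuous,
          coeFn_toL2s_of_continuous hh.continuous,
          coeFn_toL2s_of_continuous (hg.continuous.add hh.continuous)] with x h1 h2 h3 h4
        rw [h1, Pi.add_apply, h2, h3]; exact h4.symm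
      zero_mem' := by
        refine ⟨fun _ => 0, isBump_zero, Lp.ext ?_⟩
        filter_upwards [Lp.coeFn_zero ℝ 2 unitVol,
          coeFn_toL2s_of_continuous isBump_zero.continuous] with x h1 h2
        rw [h1, h2]; rfl
      smul_mem' := by
        rintro c _ ⟨g, hg, rfl⟩
        refine ⟨fun x => c * g x, ⟨contDiff_const.mul hg.1, fun x hx => by simp [hg.2 x hx]⟩,
          Lp.ext ?_⟩
        filter_upwards [Lp.coeFn_smul c (toL2s g), coeFn_toL2s_of_continuous hg.continuous,
          coeFn_toL2s_of_continuous (hg.continuous.const_smul c)] with x h1 h2 h4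
        rw [h1, Pi.smul_apply, h2]; exact h4.symm }
  have hD : D.topologicalClosure = ⊤ := by
    rw [Submodule.topologicalClosure_eq_top_iff, Submodule.eq_bot_iff]
    intro f hf
    refine eq_zero_of_inner_bump fun g hg => ?_
    rw [real_inner_comm]
    exact (Submodule.mem_orthogonal _ _).1 hf _ ⟨g, hg, rfl⟩
  exact Submodule.dense_iff_topologicalClosure_eq_top.2 hD

/-- A uniformly bounded family of operators that is strongly continuous on a dense set is jointly
continuous. -/
theorem continuous_uncurry_of_dense {E F Y : Type*} [NormedAddCommGroup E] [NormedSpace ℝ E]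
    [NormedAddCommGroup F] [NormedSpace ℝ F] [TopologicalSpace Y] {U : Y → E →L[ℝ] F} {K : ℝ}
    (hK : ∀ y f, ‖U y f‖ ≤ K * ‖f‖) {D : Set E} (hD : Dense D)
    (h : ∀ f ∈ D, Continuous fun y => U y f) : Continuous fun q : Y × E => U q.1 q.2 := by
  refine continuous_iff_continuousAt.2 fun ⟨y₀, f₀⟩ => ?_
  have hK' : ∀ y f, ‖U y f‖ ≤ (|K| + 1) * ‖f‖ := fun y f =>
    (hK y f).trans (by gcongr; exact (le_abs_self K).trans (by linarith))
  have hKp : 0 < |K| + 1 := by positivity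
  refine Metric.tendsto_nhds.2 fun ε hε => ?_
  obtain ⟨d, hd, hdf⟩ := Metric.dense_iff.1 hD f₀ (ε / (4 * (|K| + 1))) (by positivity)
  rw [Metric.mem_ball, dist_eq_norm] at hd
  have h1 : ∀ᶠ q : Y × E in 𝓝 (y₀, f₀), ‖q.2 - d‖ < ε / (4 * (|K| + 1)) :=
    (continuous_snd.sub continuous_const).norm.continuousAt.eventually_lt continuousAt_const
      (by simpa [norm_sub_rev] using hd)
  have h2 : ∀ᶠ q : Y × E in 𝓝 (y₀, f₀), ‖U q.1 d - U y₀ d‖ < ε / 4 :=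
    ((((h d hdf).comp continuous_fst).sub continuous_const).norm.continuousAt).eventually_lt
      continuousAt_const (by simpa using by positivity)
  filter_upwards [h1, h2] with q hq1 hq2
  have e : U q.1 q.2 - U y₀ f₀ = U q.1 (q.2 - d) + (U q.1 d - U y₀ d) + U y₀ (d - f₀) := by
    simp only [map_sub]; abel
  have b1 := hK' q.1 (q.2 - d)
  have b2 := hK' y₀ (d - f₀)
  have c1 : (|K| + 1) * ‖q.2 - d‖ ≤ ε / 4 := by
    calc (|K| + 1) * ‖q.2 - d‖ ≤ (|K| + 1) * (ε / (4 * (|K| + 1))) := by gcongr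
      _ = ε / 4 := by field_simp
  have c2 : (|K| + 1) * ‖d - f₀‖ ≤ ε / 4 := by
    calc (|K| + 1) * ‖d - f₀‖ ≤ (|K| + 1) * (ε / (4 * (|K| + 1))) := by gcongr
      _ = ε / 4 := by field_simp
  rw [dist_eq_norm]
  change ‖U q.1 q.2 - U y₀ f₀‖ < ε
  rw [e]
  refine (norm_add₃_le).trans_lt ?_
  linarith

theorem pullback_toL2s {p : ℝ} (hp : p ≠ 0) (s : ℝ) {g : ℝ → ℝ} (hg : IsBump g) :
    pullback p s (toL2s g) = toL2s fun x => g (p * (x - s)) := by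
  have hc : Continuous fun x => g (p * (x - s)) := hg.continuous.comp (by fun_prop)
  refine Lp.ext ?_
  filter_upwards [pullback_ae hp s (toL2s g),
    zext_affine_congr hp s (coeFn_toL2s_of_continuous hg.continuous),
    coeFn_toL2s_of_continuous hc] with x h1 h2 h3
  rw [h1, h2, h3]
  refine indicator_apply_eq_self.2 fun hx => hg.2 _ fun hx' => hx (Ioo_subset_Icc_self hx')

theorem continuous_pullback {p : ℝ} (hp : p ≠ 0) :
    Continuous fun q : ℝ × L2s => pullback p q.1 q.2 := by
  refine continuous_uncurry_of_dense (fun s f => norm_pullback_le p s f) dense_bump ?_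
  rintro _ ⟨g, hg, rfl⟩
  simp_rw [pullback_toL2s hp _ hg]
  exact continuous_toL2s (F := fun s x => g (p * (x - s))) (hg.continuous.comp (by fun_prop))

theorem continuous_pullback_comp {Y : Type*} [TopologicalSpace Y] {p : ℝ} (hp : p ≠ 0) {s : Y → ℝ}
    {f : Y → L2s} (hs : Continuous s) (hf : Continuous f) :
    Continuous fun y => pullback p (s y) (f y) := by
  have h := (continuous_pullback hp).comp (hs.prodMk hf)
  exact h

/-! ### Volterra integral operators with bounded kernels -/

theorem integral_abs_le_norm (f : L2s) : ∫ x, |f x| ∂unitVol ≤ ‖f‖ := by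
  have h1 : eLpNorm f 1 unitVol ≤ eLpNorm f 2 unitVol :=
    eLpNorm_le_eLpNorm_of_exponent_le (by norm_num) (Lp.memLp f).1
  rw [Lp.norm_def]
  refine le_trans (le_of_eq ?_) (ENNReal.toReal_mono (Lp.memLp f).2.ne h1)
  rw [eLpNorm_one_eq_lintegral_enorm, ← integral_norm_eq_lintegral_enorm (Lp.memLp f).1]
  rfl

theorem norm_le_of_ae_le {f : L2s} {C : ℝ} (hC : 0 ≤ C) (h : ∀ᵐ x ∂unitVol, ‖f x‖ ≤ C) :
    ‖f‖ ≤ C := by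
  have h1 := Lp.norm_le_of_ae_bound hC h
  have h2 : measureUnivNNReal unitVol = 1 := by simp [measureUnivNNReal]
  rw [h2] at h1
  simpa using h1

theorem measurableSet_triangle : MeasurableSet triangle := by
  have h : IsClosed triangle := by
    refine (isClosed_le continuous_const continuous_snd).inter
      ((isClosed_le continuous_snd continuous_fst).inter
        (isClosed_le continuous_fst continuous_const))
  exact h.measurableSet

/-- The Volterra operator `f ↦ ∫₀ˣ k(x,ξ) f(ξ) dξ` with an essentially bounded kernel. Its norm
between weighted spaces is at most a bound `M` for the kernel, whatever the weights, provided the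
weight `w₁` of the image at `x` does not exceed the weight `w₂` of the argument at any `ξ ≤ x`. -/
theorem exists_volterra {k : ℝ → ℝ → ℝ}
    (hk : MemLp (fun q : ℝ × ℝ => k q.1 q.2) ⊤ (volume.restrict triangle)) :
    ∃ L : L2s →L[ℝ] L2s,
      (∀ f : L2s, ∀ᵐ x ∂unitVol, IntervalIntegrable (fun ξ => k x ξ * f ξ) volume 0 x ∧
        L f x = ∫ ξ in (0 : ℝ)..x, k x ξ * f ξ) ∧
      ∃ M : ℝ, 0 ≤ M ∧ ∀ w₁ w₂ : ℝ → ℝ, MemLp w₁ ⊤ unitVol → MemLp w₂ ⊤ unitVol →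
        (∀ x ξ : ℝ, 0 ≤ ξ → ξ ≤ x → x ≤ 1 → |w₁ x| ≤ |w₂ ξ|) →
        ∀ f, ‖mulOp w₁ (L f)‖ ≤ M * ‖mulOp w₂ f‖ := by
  set κ : ℝ × ℝ → ℝ := triangle.indicator fun q => k q.1 q.2 with hκ
  have hκm : AEStronglyMeasurable κ (volume.prod volume) :=
    (aestronglyMeasurable_indicator_iff measurableSet_triangle).2 hk.1
  obtain ⟨M, hM0, hM⟩ : ∃ M : ℝ, 0 ≤ M ∧ ∀ᵐ q ∂(volume.prod volume : Measure (ℝ × ℝ)),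
      |κ q| ≤ M := by
    refine ⟨(eLpNorm (fun q : ℝ × ℝ => k q.1 q.2) ⊤ (volume.restrict triangle)).toReal,
      ENNReal.toReal_nonneg, ?_⟩
    have h1 := ae_le_eLpNormEssSup (f := fun q : ℝ × ℝ => k q.1 q.2)
      (μ := volume.restrict triangle)
    rw [ae_restrict_iff' measurableSet_triangle] at h1
    filter_upwards [h1] with q hq
    by_cases hqt : q ∈ triangle
    · have h2 := hq hqt
      rw [← eLpNorm_exponent_top] at h2
      rw [hκ, indicator_of_mem hqt, ← Real.norm_eq_abs, ← toReal_enorm]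
      exact ENNReal.toReal_mono hk.2.ne h2
    · rw [hκ, indicator_of_notMem hqt, abs_zero]; exact ENNReal.toReal_nonneg
  have hMx : ∀ᵐ x ∂unitVol, ∀ᵐ ξ ∂unitVol, |κ (x, ξ)| ≤ M :=
    ae_restrict_of_ae ((Measure.ae_ae_of_ae_prod hM).mono fun x hx => ae_restrict_of_ae hx)
  have hmx : ∀ᵐ x ∂unitVol, AEStronglyMeasurable (fun ξ => κ (x, ξ)) unitVol :=
    ae_restrict_of_ae (hκm.prodMk_left.mono fun x hx => hx.restrict)
  have hint : ∀ f : L2s, Integrable f unitVol := fun f => (Lp.memLp f).integrable (by norm_num)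
  have hint2 : ∀ᵐ x ∂unitVol, ∀ f : L2s, Integrable (fun ξ => κ (x, ξ) * f ξ) unitVol := by
    filter_upwards [hMx, hmx] with x h1 h2 f
    exact (hint f).bdd_mul h2 h1
  -- the weighted bound, pointwise in `x`
  have hpt : ∀ w₁ w₂ : ℝ → ℝ, MemLp w₂ ⊤ unitVol →
      (∀ x ξ : ℝ, 0 ≤ ξ → ξ ≤ x → x ≤ 1 → |w₁ x| ≤ |w₂ ξ|) →
      ∀ f : L2s, ∀ᵐ x ∂unitVol, ‖w₁ x * ∫ ξ, κ (x, ξ) * f ξ ∂unitVol‖ ≤ M * ‖mulOp w₂ f‖ := by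
    intro w₁ w₂ hw₂ hw f
    filter_upwards [hMx, hint2] with x h1 h2
    rw [← integral_const_mul]
    refine (norm_integral_le_integral_norm _).trans
      (le_trans ?_ (mul_le_mul_of_nonneg_left (integral_abs_le_norm _) hM0))
    rw [← integral_const_mul]
    refine integral_mono_ae ((h2 f).const_mul _).norm ((hint _).abs.const_mul _) ?_
    filter_upwards [h1, mulOp_ae hw₂ f] with ξ h3 h4
    simp only [h4, norm_mul, abs_mul, Real.norm_eq_abs]
    by_cases hq : (x, ξ) ∈ triangle
    · have h5 := hw x ξ hq.1 hq.2.1 hq.2.2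
      calc |w₁ x| * (|κ (x, ξ)| * |f ξ|) ≤ |w₂ ξ| * (M * |f ξ|) := by gcongr
        _ = M * (|w₂ ξ| * |f ξ|) := by ring
    · rw [hκ, indicator_of_notMem hq]
      simp only [abs_zero, zero_mul, mul_zero]
      positivity
  have hTm : ∀ f : L2s,
      AEStronglyMeasurable (fun x => ∫ ξ, κ (x, ξ) * f ξ ∂unitVol) unitVol := fun f => by
    have h1 : AEStronglyMeasurable κ (unitVol.prod unitVol) := by
      rw [Measure.prod_restrict]; exact hκm.restrict
    have h2 : AEStronglyMeasurable (fun q : ℝ × ℝ => f q.2) (unitVol.prod unitVol) :=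
      (Lp.memLp f).1.comp_snd
    exact (h1.mul h2).integral_prod_right'
  have hone : MemLp (fun _ : ℝ => (1 : ℝ)) ⊤ unitVol := memLp_top_of_continuous continuous_const
  have hmul1 : ∀ f : L2s, mulOp (fun _ => 1) f = f := fun f => by
    refine Lp.ext ?_
    filter_upwards [mulOp_ae hone f] with x hx
    rw [hx, one_mul]
  have hb1 : ∀ f : L2s, ∀ᵐ x ∂unitVol, ‖∫ ξ, κ (x, ξ) * f ξ ∂unitVol‖ ≤ M * ‖f‖ := fun f => by
    have h := hpt (fun _ => 1) (fun _ => 1) hone (fun _ _ _ _ _ => le_rfl) f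
    simpa only [one_mul, hmul1] using h
  have hTmem : ∀ f : L2s, MemLp (fun x => ∫ ξ, κ (x, ξ) * f ξ ∂unitVol) 2 unitVol :=
    fun f => MemLp.of_bound (hTm f) _ (hb1 f)
  obtain ⟨L, hL, -⟩ := exists_op (fun f x => ∫ ξ, κ (x, ξ) * f ξ ∂unitVol) M hTmem
    (fun f g => by
      filter_upwards [hint2] with x hx
      rw [Pi.add_apply, ← integral_add (hx f) (hx g)]
      refine integral_congr_ae ?_
      filter_upwards [Lp.coeFn_add f g] with ξ h1
      rw [h1, Pi.add_apply, mul_add])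
    (fun c f => by
      refine Eventually.of_forall fun x => ?_
      rw [Pi.smul_apply, smul_eq_mul, ← integral_const_mul]
      refine integral_congr_ae ?_
      filter_upwards [Lp.coeFn_smul c f] with ξ h1
      rw [h1, Pi.smul_apply, smul_eq_mul]; ring)
    (fun f => by
      refine norm_le_of_ae_le (by positivity) ?_
      filter_upwards [(hTmem f).coeFn_toLp, hb1 f] with x h1 h2
      rw [h1]; exact h2)
  refine ⟨L, fun f => ?_, M, hM0, fun w₁ w₂ hw₁ hw₂ hw f => ?_⟩
  · filter_upwards [hL f, hint2, ae_restrict_mem measurableSet_Icc] with x h1 h2 h3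
    have e : (fun ξ => κ (x, ξ) * f ξ) = (Icc 0 x).indicator fun ξ => k x ξ * f ξ := by
      funext ξ
      by_cases hξ : ξ ∈ Icc 0 x
      · rw [indicator_of_mem hξ, hκ, indicator_of_mem (show (x, ξ) ∈ triangle from
          ⟨hξ.1, hξ.2, h3.2⟩)]
      · rw [indicator_of_notMem hξ, hκ, indicator_of_notMem, zero_mul]
        exact fun h => hξ ⟨h.1, h.2.1⟩
    have hsub : Icc 0 x ∩ Icc (0 : ℝ) 1 = Icc 0 x :=
      inter_eq_left.2 (Icc_subset_Icc_right h3.2)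
    constructor
    · rw [intervalIntegrable_iff_integrableOn_Icc_of_le h3.1]
      have h4 := h2 f
      rw [e, integrable_indicator_iff measurableSet_Icc, IntegrableOn,
        Measure.restrict_restrict measurableSet_Icc, hsub] at h4
      exact h4
    · rw [h1, e, integral_indicator measurableSet_Icc, Measure.restrict_restrict measurableSet_Icc,
        hsub, intervalIntegral.integral_of_le h3.1, integral_Icc_eq_integral_Ioc]
  · refine norm_le_of_ae_le (by positivity) ?_
    filter_upwards [mulOp_ae hw₁ (L f), hL f, hpt w₁ w₂ hw₂ hw f] with x h1 h2 h3
    rw [h1, h2]; exact h3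

/-! ### Mild solutions of linear evolution equations -/

section Mild

variable {E F : Type*} [NormedAddCommGroup E] [NormedSpace ℝ E]
  [NormedAddCommGroup F] [NormedSpace ℝ F]

theorem norm_integral_le_of_exp_bound {g : ℝ → E} {δ C τ : ℝ} (hδ : 0 < δ) (hC : 0 ≤ C)
    (hτ : 0 ≤ τ) (hg : ∀ s, 0 ≤ s → s ≤ τ → ‖g s‖ ≤ C * Real.exp (-δ * (τ - s))) :
    ‖∫ s in (0 : ℝ)..τ, g s‖ ≤ C / δ := by
  have hint : ∫ s in (0 : ℝ)..τ, C * Real.exp (-δ * (τ - s))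
      = C / δ * Real.exp (-δ * (τ - τ)) - C / δ * Real.exp (-δ * (τ - 0)) := by
    refine intervalIntegral.integral_eq_sub_of_hasDerivAt
      (f := fun s => C / δ * Real.exp (-δ * (τ - s))) (fun s _ => ?_)
      (Continuous.intervalIntegrable (by fun_prop) _ _)
    have h1 : HasDerivAt (fun s => -δ * (τ - s)) δ s := by
      simpa using ((hasDerivAt_id s).const_sub τ).const_mul (-δ)
    refine ((h1.exp).const_mul (C / δ)).congr_deriv ?_
    rw [mul_comm (Real.exp _) δ, ← mul_assoc, div_mul_cancel₀ C hδ.ne']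
  refine (intervalIntegral.norm_integral_le_of_norm_le hτ
    (Eventually.of_forall fun s hs => hg s hs.1.le hs.2)
    (Continuous.intervalIntegrable (by fun_prop) _ _)).trans ?_
  rw [hint]
  have : 0 ≤ C / δ * Real.exp (-δ * (τ - 0)) := by positivity
  simp only [sub_self, mul_zero, Real.exp_zero, mul_one]
  linarith

/-- Picard's fixed point argument, in a space of curves that grow at most like `e^{γt}`. -/
theorem exists_mild [CompleteSpace E] {U : ℝ → E →L[ℝ] E}
    (hU : Continuous fun q : ℝ × E => U q.1 q.2) {K : ℝ} (hK : ∀ t f, ‖U t f‖ ≤ K * ‖f‖)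
    (B : E →L[ℝ] E) (w₀ : E) :
    ∃ w : ℝ → E, Continuous w ∧
      ∀ t, 0 ≤ t → w t = U t w₀ + ∫ s in (0 : ℝ)..t, U (t - s) (B (w s)) := by
  wlog hK0 : 0 ≤ K generalizing K
  · exact this (K := |K|) (fun t f => (hK t f).trans (by gcongr; exact le_abs_self K)) (abs_nonneg K)
  set γ : ℝ := 2 * (K * ‖B‖) + 1 with hγ
  have hγ0 : 0 < γ := by positivity
  have hcont : ∀ u : ℝ → E, Continuous u → Continuous fun q : ℝ × ℝ =>
      Real.exp (-γ * (max q.1 0 - q.2)) • U (max q.1 0 - q.2) (B (u q.2)) := fun u hu => by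
    refine Continuous.smul (by fun_prop) ?_
    exact hU.comp (((continuous_fst.max continuous_const).sub continuous_snd).prodMk
      (B.continuous.comp (hu.comp continuous_snd)))
  have hbd : ∀ (u : ℝ → E) (C : ℝ), 0 ≤ C → (∀ s, ‖u s‖ ≤ C) → ∀ t,
      ‖∫ s in (0 : ℝ)..max t 0, Real.exp (-γ * (max t 0 - s)) • U (max t 0 - s) (B (u s))‖
        ≤ K * ‖B‖ * C / γ := by
    intro u C hC hu t
    refine norm_integral_le_of_exp_bound hγ0 (by positivity) (le_max_right _ _) fun s _ _ => ?_
    rw [norm_smul, Real.norm_eq_abs, Real.abs_exp, mul_comm]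
    gcongr
    calc _ ≤ K * ‖B (u s)‖ := hK _ _
      _ ≤ K * (‖B‖ * C) := by
        gcongr
        exact (B.le_opNorm _).trans (by gcongr; exact hu s)
      _ = _ := by ring
  let Γ : BoundedContinuousFunction ℝ E → BoundedContinuousFunction ℝ E := fun u =>
    BoundedContinuousFunction.ofNormedAddCommGroup
      (fun t => Real.exp (-γ * max t 0) • U (max t 0) w₀
        + ∫ s in (0 : ℝ)..max t 0, Real.exp (-γ * (max t 0 - s)) • U (max t 0 - s) (B (u s)))
      (by
        refine Continuous.add (Continuous.smul (by fun_prop) ?_) ?_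
        · exact hU.comp ((continuous_id.max continuous_const).prodMk continuous_const)
        · exact intervalIntegral.continuous_parametric_intervalIntegral_of_continuous
            (hcont u u.continuous) (by fun_prop))
      (K * ‖w₀‖ + K * ‖B‖ * ‖u‖ / γ) (fun t => by
        refine (norm_add_le _ _).trans (add_le_add ?_ (hbd u _ (norm_nonneg _) u.norm_coe_le_norm t))
        rw [norm_smul, Real.norm_eq_abs, Real.abs_exp]
        calc _ ≤ 1 * (K * ‖w₀‖) := by
              gcongr
              · refine Real.exp_le_one_iff.2 ?_
                have := le_max_right t 0
                nlinarith
              · exact hK _ _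
          _ = _ := one_mul _)
  have hΓ : ContractingWith (1 / 2) Γ := by
    refine ⟨by rw [← NNReal.coe_lt_coe]; norm_num, LipschitzWith.of_dist_le_mul fun u v => ?_⟩
    rw [BoundedContinuousFunction.dist_le (by positivity)]
    intro t
    have e : Γ u t - Γ v t = ∫ s in (0 : ℝ)..max t 0,
        Real.exp (-γ * (max t 0 - s)) • U (max t 0 - s) (B ((u - v) s)) := by
      have h1 : ∀ u : BoundedContinuousFunction ℝ E, IntervalIntegrable
          (fun s => Real.exp (-γ * (max t 0 - s)) • U (max t 0 - s) (B (u s))) volume 0 (max t 0) :=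
        fun u => ((hcont u u.continuous).comp
          (continuous_const.prodMk continuous_id)).intervalIntegrable _ _
      simp only [Γ, BoundedContinuousFunction.coe_ofNormedAddCommGroup, add_sub_add_left_eq_sub]
      rw [← intervalIntegral.integral_sub (h1 u) (h1 v)]
      simp only [BoundedContinuousFunction.coe_sub, Pi.sub_apply, map_sub, smul_sub]
    rw [dist_eq_norm, e, dist_eq_norm]
    refine (hbd _ ‖u - v‖ (norm_nonneg _) (u - v).norm_coe_le_norm t).trans ?_
    rw [div_le_iff₀ hγ0]
    push_cast
    have := norm_nonneg (u - v)
    nlinarith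
  have hfix := hΓ.fixedPoint_isFixedPt
  set u := ContractingWith.fixedPoint Γ hΓ
  refine ⟨fun t => Real.exp (γ * t) • u t, by fun_prop, fun t ht => ?_⟩
  have h1 : u t = Real.exp (-γ * t) • U t w₀
      + ∫ s in (0 : ℝ)..t, Real.exp (-γ * (t - s)) • U (t - s) (B (u s)) := by
    have h2 : Γ u t = u t := by rw [hfix]
    rw [← h2]
    simp only [Γ, BoundedContinuousFunction.coe_ofNormedAddCommGroup, max_eq_left ht]
  simp only
  rw [h1, smul_add, smul_smul, ← Real.exp_add, ← intervalIntegral.integral_smul]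
  congr 1
  · simp
  · refine intervalIntegral.integral_congr fun s _ => ?_
    simp only [map_smul, smul_smul, ← Real.exp_add]
    congr 2
    ring

/-- Exponential decay of mild solutions, measured through a map `W`: a perturbation whose size is
at most half of the gap between the rates `δ` and `κ` costs a factor `2`. -/
theorem mild_decay [CompleteSpace F] [CompleteSpace E] {U : ℝ → E →L[ℝ] E}
    (hU : Continuous fun q : ℝ × E => U q.1 q.2) {B : E →L[ℝ] E} {W : E →L[ℝ] F}
    {K b δ κ : ℝ} (hK : 0 ≤ K) (hb : 0 ≤ b) (hκδ : κ < δ) (hKb : 2 * (K * b) ≤ δ - κ)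
    (hdec : ∀ t, 0 ≤ t → ∀ f, ‖W (U t f)‖ ≤ K * Real.exp (-δ * t) * ‖W f‖)
    (hB : ∀ f, ‖W (B f)‖ ≤ b * ‖W f‖) {w : ℝ → E} (hw : Continuous w) {w₀ : E}
    (hmild : ∀ t, 0 ≤ t → w t = U t w₀ + ∫ s in (0 : ℝ)..t, U (t - s) (B (w s)))
    {t : ℝ} (ht : 0 ≤ t) :
    ‖W (w t)‖ ≤ 2 * K * Real.exp (-κ * t) * ‖W w₀‖ := by
  set y : ℝ → ℝ := fun s => Real.exp (κ * s) * ‖W (w s)‖ with hy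
  have hyc : Continuous y := by fun_prop
  obtain ⟨r, hr, hmax⟩ := isCompact_Icc.exists_isMaxOn (nonempty_Icc.2 ht) hyc.continuousOn
  have hy0 : ∀ s, 0 ≤ y s := fun s => by positivity
  have hWy : ∀ s, ‖W (w s)‖ = Real.exp (-κ * s) * y s := fun s => by
    rw [hy]
    simp only [← mul_assoc, ← Real.exp_add]
    simp
  have h1 : W (w r) = W (U r w₀) + ∫ s in (0 : ℝ)..r, W (U (r - s) (B (w s))) := by
    have hi : IntervalIntegrable (fun s => U (r - s) (B (w s))) volume 0 r :=
      (hU.comp ((continuous_const.sub continuous_id).prodMk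
        (B.continuous.comp hw))).intervalIntegrable _ _
    rw [W.intervalIntegral_comp_comm hi, ← map_add, ← hmild r hr.1]
  have h2 : ‖∫ s in (0 : ℝ)..r, Real.exp (κ * r) • W (U (r - s) (B (w s)))‖
      ≤ K * b * y r / (δ - κ) := by
    refine norm_integral_le_of_exp_bound (sub_pos.2 hκδ)
      (mul_nonneg (by positivity) (hy0 r)) hr.1 fun s hs0 hsr => ?_
    have h3 := hmax (show s ∈ Icc 0 t from ⟨hs0, hsr.trans hr.2⟩)
    rw [norm_smul, Real.norm_eq_abs, Real.abs_exp]
    calc _ ≤ Real.exp (κ * r) * (K * Real.exp (-δ * (r - s)) * (b * (Real.exp (-κ * s) * y r))) := by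
          gcongr
          refine (hdec _ (by linarith) _).trans ?_
          gcongr
          refine (hB _).trans ?_
          rw [hWy]
          gcongr
          exact h3
      _ = K * b * y r * (Real.exp (κ * r) * Real.exp (-δ * (r - s)) * Real.exp (-κ * s)) := by ring
      _ = _ := by
          rw [← Real.exp_add, ← Real.exp_add]
          congr 2
          ring
  have h4 : K * b * y r / (δ - κ) ≤ y r / 2 := by
    rw [div_le_div_iff₀ (sub_pos.2 hκδ) two_pos]
    nlinarith [hy0 r]
  have h5 : y r ≤ K * ‖W w₀‖ + y r / 2 := by
    calc y r = ‖Real.exp (κ * r) • W (w r)‖ := by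
          rw [norm_smul, Real.norm_eq_abs, Real.abs_exp]
      _ ≤ ‖Real.exp (κ * r) • W (U r w₀)‖
          + ‖∫ s in (0 : ℝ)..r, Real.exp (κ * r) • W (U (r - s) (B (w s)))‖ := by
          rw [h1, smul_add, ← intervalIntegral.integral_smul]; exact norm_add_le _ _
      _ ≤ _ := by
          refine add_le_add ?_ (h2.trans h4)
          rw [norm_smul, Real.norm_eq_abs, Real.abs_exp]
          calc _ ≤ Real.exp (κ * r) * (K * Real.exp (-δ * r) * ‖W w₀‖) := by
                gcongr; exact hdec r hr.1 _
            _ = (Real.exp (κ * r) * Real.exp (-δ * r)) * (K * ‖W w₀‖) := by ring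
            _ ≤ 1 * (K * ‖W w₀‖) := by
                gcongr
                rw [← Real.exp_add]
                refine Real.exp_le_one_iff.2 ?_
                nlinarith [hr.1]
            _ = _ := one_mul _
  have h6 : y t ≤ 2 * (K * ‖W w₀‖) := by
    have := hmax (show t ∈ Icc 0 t from ⟨ht, le_rfl⟩)
    simp only [mem_ofPred_eq] at this
    linarith
  rw [hWy]
  calc Real.exp (-κ * t) * y t ≤ Real.exp (-κ * t) * (2 * (K * ‖W w₀‖)) := by gcongr
    _ = _ := by ring

theorem integral_triangle_swap {G : ℝ → ℝ → ℝ} (hG : Continuous (Function.uncurry G)) {T : ℝ}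
    (hT : 0 ≤ T) :
    ∫ s in (0 : ℝ)..T, ∫ t in s..T, G s t = ∫ t in (0 : ℝ)..T, ∫ s in (0 : ℝ)..t, G s t := by
  set A : Set (ℝ × ℝ) := {q | q.1 < q.2} with hA
  have hAm : MeasurableSet A := measurableSet_lt measurable_fst measurable_snd
  set I : ℝ → ℝ → ℝ := fun s t => A.indicator (Function.uncurry G) (s, t) with hI
  have hsw := intervalIntegral_intervalIntegral_swap (F := I) (a := 0) (b := T) (c := 0) (d := T)
    (by
      have h1 : IntegrableOn (Function.uncurry G) (uIoc 0 T ×ˢ uIoc 0 T) := by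
        refine (hG.continuousOn.integrableOn_compact
          ((isCompact_uIcc (a := 0) (b := T)).prod (isCompact_uIcc (a := 0) (b := T)))).mono_set ?_
        exact prod_mono uIoc_subset_uIcc uIoc_subset_uIcc
      exact h1.indicator hAm)
  have hl : ∀ s ∈ uIcc 0 T, ∫ t in s..T, G s t = ∫ t in (0 : ℝ)..T, I s t := fun s hs => by
    rw [uIcc_of_le hT] at hs
    have e : (fun t => I s t) = (Ioi s).indicator (G s) := by
      funext t
      simp only [hI, hA, indicator_apply, mem_ofPred_eq, mem_Ioi, Function.uncurry_apply_pair]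
    rw [e, intervalIntegral.integral_of_le hs.2, intervalIntegral.integral_of_le hT,
      integral_indicator measurableSet_Ioi, Measure.restrict_restrict measurableSet_Ioi]
    congr 2
    ext t
    simp only [mem_inter_iff, mem_Ioi, mem_Ioc]
    constructor
    · exact fun h => ⟨h.1, hs.1.trans_lt h.1, h.2⟩
    · exact fun h => ⟨h.1, h.2.2⟩
  have hr : ∀ t ∈ uIcc 0 T, ∫ s in (0 : ℝ)..t, G s t = ∫ s in (0 : ℝ)..T, I s t := fun t ht => by
    rw [uIcc_of_le hT] at ht
    have e : (fun s => I s t) = (Iio t).indicator fun s => G s t := by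
      funext s
      simp only [hI, hA, indicator_apply, mem_ofPred_eq, mem_Iio, Function.uncurry_apply_pair]
    rw [e, intervalIntegral.integral_of_le ht.1, intervalIntegral.integral_of_le hT,
      integral_indicator measurableSet_Iio, Measure.restrict_restrict measurableSet_Iio,
      integral_Ioc_eq_integral_Ioo]
    congr 2
    ext s
    simp only [mem_inter_iff, mem_Iio, mem_Ioc, mem_Ioo]
    constructor
    · exact fun h => ⟨h.2, h.1, h.2.le.trans ht.2⟩
    · exact fun h => ⟨h.2.1, h.1⟩
  rw [intervalIntegral.integral_congr hl, intervalIntegral.integral_congr hr]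
  exact hsw

/-- Duhamel's formula turns the weak identity of the free evolution `U`, started at any time `s`,
into the weak identity with a source `f`. `P v` is the pairing with the test vector `v`. -/
theorem weak_of_duhamel [CompleteSpace E] {U : ℝ → E →L[ℝ] E}
    (hU : Continuous fun q : ℝ × E => U q.1 q.2) {P : E → E →L[ℝ] ℝ}
    (hP : Continuous fun q : E × E => P q.1 q.2) {Φ Ψ : ℝ → E} (hΦ : Continuous Φ)
    (hΨ : Continuous Ψ) {T : ℝ} (hT : 0 ≤ T)
    (hweak : ∀ s, 0 ≤ s → s ≤ T → ∀ f : E,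
      P (Φ T) (U (T - s) f) = P (Φ s) f + ∫ t in s..T, P (Ψ t) (U (t - s) f))
    {f w : ℝ → E} (hf : Continuous f) {w₀ : E}
    (hw : ∀ t, 0 ≤ t → w t = U t w₀ + ∫ s in (0 : ℝ)..t, U (t - s) (f s)) :
    P (Φ T) (w T) = P (Φ 0) w₀ + ∫ t in (0 : ℝ)..T, (P (Ψ t) (w t) + P (Φ t) (f t)) := by
  have hUf : Continuous fun q : ℝ × ℝ => U (q.2 - q.1) (f q.1) :=
    hU.comp ((continuous_snd.sub continuous_fst).prodMk (hf.comp continuous_fst))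
  have hUi : ∀ t, IntervalIntegrable (fun s => U (t - s) (f s)) volume 0 t := fun t =>
    (hUf.comp (continuous_id.prodMk continuous_const)).intervalIntegrable _ _
  have hG : Continuous (Function.uncurry fun s t => P (Ψ t) (U (t - s) (f s))) :=
    hP.comp ((hΨ.comp continuous_snd).prodMk hUf)
  have hPw : ∀ v t, 0 ≤ t →
      P v (w t) = P v (U t w₀) + ∫ s in (0 : ℝ)..t, P v (U (t - s) (f s)) := fun v t ht => by
    rw [hw t ht, map_add, (P v).intervalIntegral_comp_comm (hUi t)]
  have c1 : Continuous fun t => P (Ψ t) (U t w₀) :=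
    hP.comp (hΨ.prodMk (hU.comp (continuous_id.prodMk continuous_const)))
  have c2 : Continuous fun t => ∫ s in (0 : ℝ)..t, P (Ψ t) (U (t - s) (f s)) := by
    have h1 : Continuous (Function.uncurry fun t s => P (Ψ t) (U (t - s) (f s))) :=
      hG.comp continuous_swap
    exact intervalIntegral.continuous_parametric_intervalIntegral_of_continuous h1 continuous_id
  have c3 : Continuous fun t => P (Φ t) (f t) := hP.comp (hΦ.prodMk hf)
  have c4 : Continuous fun s => ∫ t in s..T, P (Ψ t) (U (t - s) (f s)) := by
    have e : (fun s => ∫ t in s..T, P (Ψ t) (U (t - s) (f s)))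
        = fun s => -∫ t in T..s, P (Ψ t) (U (t - s) (f s)) :=
      funext fun s => intervalIntegral.integral_symm T s
    rw [e]
    exact (intervalIntegral.continuous_parametric_intervalIntegral_of_continuous hG
      continuous_id).neg
  have e1 : ∫ t in (0 : ℝ)..T, P (Ψ t) (w t)
      = (∫ t in (0 : ℝ)..T, P (Ψ t) (U t w₀))
        + ∫ s in (0 : ℝ)..T, ∫ t in s..T, P (Ψ t) (U (t - s) (f s)) := by
    rw [integral_triangle_swap hG hT, ← intervalIntegral.integral_add
      (c1.intervalIntegrable _ _) (c2.intervalIntegrable _ _)]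
    refine intervalIntegral.integral_congr fun t ht => ?_
    rw [uIcc_of_le hT] at ht
    exact hPw _ t ht.1
  have e2 : ∫ s in (0 : ℝ)..T, P (Φ T) (U (T - s) (f s))
      = (∫ s in (0 : ℝ)..T, P (Φ s) (f s))
        + ∫ s in (0 : ℝ)..T, ∫ t in s..T, P (Ψ t) (U (t - s) (f s)) := by
    rw [← intervalIntegral.integral_add (c3.intervalIntegrable _ _) (c4.intervalIntegrable _ _)]
    refine intervalIntegral.integral_congr fun s hs => ?_
    rw [uIcc_of_le hT] at hs
    exact hweak s hs.1 hs.2 _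
  have i1 : IntervalIntegrable (fun t => P (Ψ t) (w t)) volume 0 T := by
    refine ((c1.add c2).intervalIntegrable _ _).congr fun t ht => ?_
    rw [uIoc_of_le hT] at ht
    exact (hPw _ t ht.1.le).symm
  have e3 := hweak 0 le_rfl hT w₀
  simp only [sub_zero] at e3
  rw [intervalIntegral.integral_add i1 (c3.intervalIntegrable _ _), hPw _ T hT, e1, e2, e3]
  ring

end Mild

/-! ### Matrices of operators on the components of the state -/

theorem norm_mulOp_le_of_ae {w : ℝ → ℝ} (hw : MemLp w ⊤ unitVol) {f g : L2s} {c : ℝ}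
    (h : ∀ᵐ x ∂unitVol, ‖w x * f x‖ ≤ c * ‖g x‖) : ‖mulOp w f‖ ≤ c * ‖g‖ := by
  refine Lp.norm_le_mul_norm_of_ae_le_mul ?_
  filter_upwards [mulOp_ae hw f, h] with x h1 h2
  rwa [h1]

theorem norm_mulOp_mono {w₁ w₂ : ℝ → ℝ} (h₁ : MemLp w₁ ⊤ unitVol) (h₂ : MemLp w₂ ⊤ unitVol)
    (h : ∀ x ∈ Icc (0 : ℝ) 1, |w₁ x| ≤ |w₂ x|) (f : L2s) : ‖mulOp w₁ f‖ ≤ ‖mulOp w₂ f‖ := by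
  rw [← one_mul ‖mulOp w₂ f‖]
  refine norm_mulOp_le_of_ae h₁ ?_
  filter_upwards [mulOp_ae h₂ f, ae_restrict_mem measurableSet_Icc] with x h3 h4
  rw [h3, one_mul, norm_mul, norm_mul]
  gcongr
  exact h x h4

theorem mulOp_comm {w g : ℝ → ℝ} (hw : MemLp w ⊤ unitVol) (hg : MemLp g ⊤ unitVol) (f : L2s) :
    mulOp w (mulOp g f) = mulOp g (mulOp w f) := by
  refine Lp.ext ?_
  filter_upwards [mulOp_ae hw (mulOp g f), mulOp_ae hg f, mulOp_ae hg (mulOp w f),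
    mulOp_ae hw f] with x h1 h2 h3 h4
  rw [h1, h2, h3, h4]; ring

/-- The state space of the system, by scalar components: `n` components of `α`, then `m` of `β`. -/
abbrev State (n m : ℕ) : Type := Fin n ⊕ Fin m → L2s

variable {n m : ℕ}

/-- The operator on the state with the given matrix of operators on scalar components. -/
def opMatrix (A : Fin n ⊕ Fin m → Fin n ⊕ Fin m → L2s →L[ℝ] L2s) : State n m →L[ℝ] State n m :=
  ContinuousLinearMap.pi fun k => ∑ l, (A k l).comp (ContinuousLinearMap.proj l)

theorem opMatrix_apply (A : Fin n ⊕ Fin m → Fin n ⊕ Fin m → L2s →L[ℝ] L2s) (w : State n m)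
    (k : Fin n ⊕ Fin m) : opMatrix A w k = ∑ l, A k l (w l) := by
  simp [opMatrix]

/-- The diagonal operator on the state. -/
def opDiag (V : Fin n ⊕ Fin m → L2s →L[ℝ] L2s) : State n m →L[ℝ] State n m :=
  ContinuousLinearMap.pi fun k => (V k).comp (ContinuousLinearMap.proj k)

theorem opDiag_apply (V : Fin n ⊕ Fin m → L2s →L[ℝ] L2s) (w : State n m)
    (k : Fin n ⊕ Fin m) : opDiag V w k = V k (w k) := rfl

theorem norm_opDiag_opMatrix_le {V : Fin n ⊕ Fin m → L2s →L[ℝ] L2s}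
    {A : Fin n ⊕ Fin m → Fin n ⊕ Fin m → L2s →L[ℝ] L2s} {c : Fin n ⊕ Fin m → Fin n ⊕ Fin m → ℝ}
    (hc : ∀ k l, 0 ≤ c k l) (h : ∀ k l f, ‖V k (A k l f)‖ ≤ c k l * ‖V l f‖) (w : State n m) :
    ‖opDiag V (opMatrix A w)‖ ≤ (∑ k, ∑ l, c k l) * ‖opDiag V w‖ := by
  have h0 : 0 ≤ ∑ k, ∑ l, c k l := Finset.sum_nonneg fun k _ => Finset.sum_nonneg fun l _ => hc k l
  refine (pi_norm_le_iff_of_nonneg (by positivity)).2 fun k => ?_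
  rw [opDiag_apply, opMatrix_apply, map_sum]
  calc ‖∑ l, V k (A k l (w l))‖ ≤ ∑ l, ‖V k (A k l (w l))‖ := norm_sum_le _ _
    _ ≤ ∑ l, c k l * ‖opDiag V w‖ := by
        refine Finset.sum_le_sum fun l _ => (h k l _).trans ?_
        exact mul_le_mul_of_nonneg_left (norm_le_pi_norm (opDiag V w) l) (hc k l)
    _ = (∑ l, c k l) * ‖opDiag V w‖ := by rw [Finset.sum_mul]
    _ ≤ _ := by
        refine mul_le_mul_of_nonneg_right ?_ (norm_nonneg _)
        exact Finset.single_le_sum (f := fun k => ∑ l, c k l)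
          (fun k _ => Finset.sum_nonneg fun l _ => hc k l) (Finset.mem_univ k)

/-- The pairing `∑ₖ ⟨vₖ, wₖ⟩` of `L²([0,1]; ℝⁿ × ℝᵐ)`, as a functional of `w`. -/
def pairing (v : State n m) : State n m →L[ℝ] ℝ :=
  ∑ k, (innerSL ℝ (v k)).comp (ContinuousLinearMap.proj k)

theorem pairing_apply (v w : State n m) : pairing v w = ∑ k, inner ℝ (v k) (w k) := by
  simp [pairing]

theorem continuous_pairing : Continuous fun q : State n m × State n m => pairing q.1 q.2 := by
  simp_rw [pairing_apply]
  fun_prop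

/-! ### Exponential weights -/

/-- The weights `e^{-νx}` on `α` and `e^{νx}` on `β`: each decreases in the direction of transport
of its component. -/
def weight (ν : ℝ) : Fin n ⊕ Fin m → ℝ → ℝ
  | Sum.inl _, x => Real.exp (-(ν * x))
  | Sum.inr _, x => Real.exp (ν * x)

theorem weight_pos (ν : ℝ) (k : Fin n ⊕ Fin m) (x : ℝ) : 0 < weight ν k x := by
  cases k <;> exact Real.exp_pos _

theorem memLp_weight (ν : ℝ) (k : Fin n ⊕ Fin m) : MemLp (weight ν k) ⊤ unitVol := by
  refine memLp_top_of_continuous ?_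
  cases k
  · exact Real.continuous_exp.comp (by fun_prop)
  · exact Real.continuous_exp.comp (by fun_prop)

/-- Multiplication of each component by its weight. -/
def weightOp (ν : ℝ) : State n m →L[ℝ] State n m := opDiag fun k => mulOp (weight ν k)

theorem norm_le_norm_weightOp {ν : ℝ} (hν : 0 ≤ ν) (w : State n m) :
    ‖w‖ ≤ Real.exp ν * ‖weightOp ν w‖ := by
  refine (pi_norm_le_iff_of_nonneg (by positivity)).2 fun k => ?_
  refine le_trans ?_ (mul_le_mul_of_nonneg_left (norm_le_pi_norm (weightOp ν w) k) (by positivity))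
  refine Lp.norm_le_mul_norm_of_ae_le_mul ?_
  filter_upwards [mulOp_ae (memLp_weight ν k) (w k), ae_restrict_mem measurableSet_Icc]
    with x h1 h2
  change _ ≤ Real.exp ν * ‖mulOp (weight ν k) (w k) x‖
  rw [h1, norm_mul, ← mul_assoc]
  refine le_mul_of_one_le_left (norm_nonneg _) ?_
  rw [Real.norm_eq_abs, abs_of_pos (weight_pos ν k x)]
  cases k
  · rw [weight, ← Real.exp_add, Real.one_le_exp_iff]
    nlinarith [h2.1, h2.2]
  · rw [weight, ← Real.exp_add, Real.one_le_exp_iff]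
    nlinarith [h2.1, h2.2]

namespace TargetSystem

variable (S : TargetSystem n m)

/-! ### The free transport -/

/-- The signed speeds: `λᵢ` for `α`, `-μⱼ` for `β`. -/
def speed : Fin n ⊕ Fin m → ℝ
  | Sum.inl i => S.lam i
  | Sum.inr j => -S.mu j

/-- How much of the initial component `l` is transported into the component `k`: all of it if
`k = l`, and `Q₀` times `β` through the boundary condition at `x = 0`. -/
def coeff : Fin n ⊕ Fin m → Fin n ⊕ Fin m → ℝ
  | Sum.inl i, Sum.inl l => if i = l then 1 else 0
  | Sum.inl i, Sum.inr j => S.Q0 i j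
  | Sum.inr _, Sum.inl _ => 0
  | Sum.inr j, Sum.inr l => if j = l then 1 else 0

/-- The change of scale along the characteristics that carry component `l` into component `k`. -/
def slope : Fin n ⊕ Fin m → Fin n ⊕ Fin m → ℝ
  | Sum.inl i, Sum.inr j => -(S.mu j / S.lam i)
  | Sum.inl _, Sum.inl _ => 1
  | Sum.inr _, Sum.inl _ => 1
  | Sum.inr _, Sum.inr _ => 1

theorem slope_ne_zero (k l : Fin n ⊕ Fin m) : S.slope k l ≠ 0 := by
  rcases k with i | j <;> rcases l with i' | j' <;> simp only [slope, ne_eq, one_ne_zero,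
    not_false_eq_true]
  exact neg_ne_zero.2 (div_pos (S.mu_pos j') (S.lam_pos i)).ne'

/-- The solution operator of the system without right-hand sides: the solution is constant along
characteristics, and those of `α` that start at `x = 0` carry on with `Q₀ β`. Thus
`αᵢ(t,x) = αᵢ⁰(x - λᵢt) + ∑ⱼ Q₀ᵢⱼ βⱼ⁰(μⱼ(t - x/λᵢ))` and `βⱼ(t,x) = βⱼ⁰(x + μⱼt)`, with data
extended by zero outside `[0,1]`. -/
def transport (t : ℝ) : State n m →L[ℝ] State n m :=
  opMatrix fun k l => S.coeff k l • pullback (S.slope k l) (S.speed k * t)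

theorem transport_apply (t : ℝ) (w : State n m) (k : Fin n ⊕ Fin m) :
    S.transport t w k
      = ∑ l, S.coeff k l • pullback (S.slope k l) (S.speed k * t) (w l) := by
  rw [transport, opMatrix_apply]; rfl

theorem continuous_transport : Continuous fun q : ℝ × State n m => S.transport q.1 q.2 := by
  refine continuous_pi fun k => ?_
  have h : ∀ l, Continuous fun q : ℝ × State n m =>
      pullback (S.slope k l) (S.speed k * q.1) (q.2 l) := fun l =>
    continuous_pullback_comp (S.slope_ne_zero k l) (by fun_prop) (by fun_prop)
  have h2 : Continuous fun q : ℝ × State n m =>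
      ∑ l, S.coeff k l • pullback (S.slope k l) (S.speed k * q.1) (q.2 l) :=
    continuous_finsetSum _ fun l _ => (h l).const_smul (S.coeff k l)
  exact h2.congr fun q => (S.transport_apply q.1 q.2 k).symm

/-- A bound for the free transport. -/
def transportBound : ℝ := ∑ k, ∑ l, |S.coeff k l| * |(S.slope k l)⁻¹| ^ (1 / 2 : ℝ)

theorem transportBound_nonneg : 0 ≤ S.transportBound := by unfold transportBound; positivity

theorem norm_transport_le (t : ℝ) (w : State n m) :
    ‖S.transport t w‖ ≤ S.transportBound * ‖w‖ := by
  refine norm_opDiag_opMatrix_le (V := fun _ => ContinuousLinearMap.id ℝ L2s)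
    (fun k l => by positivity) (fun k l f => ?_) w
  simp only [ContinuousLinearMap.id_apply, _root_.smul_apply, norm_smul,
    Real.norm_eq_abs, mul_assoc]
  gcongr
  exact norm_pullback_le _ _ _

/-- A positive lower bound for all speeds. -/
theorem exists_speed_lower_bound : ∃ c : ℝ, 0 < c ∧ (∀ i, c ≤ S.lam i) ∧ ∀ j, c ≤ S.mu j := by
  have h1 : ∃ c : ℝ, 0 < c ∧ ∀ i, c ≤ S.lam i := by
    rcases isEmpty_or_nonempty (Fin n) with h | h
    · exact ⟨1, one_pos, fun i => h.elim i⟩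
    · obtain ⟨i, hi⟩ := Finite.exists_min S.lam
      exact ⟨S.lam i, S.lam_pos i, hi⟩
  have h2 : ∃ c : ℝ, 0 < c ∧ ∀ j, c ≤ S.mu j := by
    rcases isEmpty_or_nonempty (Fin m) with h | h
    · exact ⟨1, one_pos, fun i => h.elim i⟩
    · obtain ⟨i, hi⟩ := Finite.exists_min S.mu
      exact ⟨S.mu i, S.mu_pos i, hi⟩
  obtain ⟨c, hc, hc'⟩ := h1
  obtain ⟨d, hd, hd'⟩ := h2
  exact ⟨min c d, lt_min hc hd, fun i => (min_le_left _ _).trans (hc' i),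
    fun j => (min_le_right _ _).trans (hd' j)⟩

/-- In the weighted norm the free transport decays at a rate proportional to `ν`, with a constant
that does not depend on `ν`. -/
theorem norm_weightOp_transport_le {c : ℝ} (hl : ∀ i, c ≤ S.lam i)
    (hm : ∀ j, c ≤ S.mu j) {ν : ℝ} (hν : 0 ≤ ν) {t : ℝ} (ht : 0 ≤ t) (w : State n m) :
    ‖weightOp ν (S.transport t w)‖
      ≤ S.transportBound * Real.exp (-(ν * c) * t) * ‖weightOp ν w‖ := by
  have h := norm_opDiag_opMatrix_le (V := fun k => mulOp (weight ν k))
    (A := fun k l => S.coeff k l • pullback (S.slope k l) (S.speed k * t))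
    (c := fun k l => (|S.coeff k l| * |(S.slope k l)⁻¹| ^ (1 / 2 : ℝ))
      * Real.exp (-(ν * c) * t)) (fun k l => by positivity) (fun k l f => ?_) w
  · simp_rw [← Finset.sum_mul] at h
    exact h
  rw [_root_.smul_apply, map_smul, norm_smul, Real.norm_eq_abs, mul_assoc, mul_assoc]
  by_cases hkl : S.coeff k l = 0
  · simp [hkl]
  refine mul_le_mul_of_nonneg_left ?_ (abs_nonneg _)
  refine (norm_mulOp_pullback_le (S.slope_ne_zero k l) (θ := Real.exp (-(ν * c) * t))
    (Real.exp_pos _).le (memLp_weight ν k) (memLp_weight ν l) (fun x hx hy => ?_) f).trans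
    (le_of_eq (by ring))
  rw [abs_of_pos (weight_pos ν k x), abs_of_pos (weight_pos ν l _)]
  rcases k with i | j <;> rcases l with i' | j'
  · simp only [weight, speed, slope, one_mul, ← Real.exp_add, Real.exp_le_exp]
    nlinarith [mul_nonneg (mul_nonneg hν ht) (sub_nonneg.2 (hl i))]
  · simp only [weight, speed, slope, ← Real.exp_add, Real.exp_le_exp] at hy ⊢
    set y := -(S.mu j' / S.lam i) * (x - S.lam i * t) with hydef
    have hli := S.lam_pos i
    have hmj := S.mu_pos j'
    -- `x / λᵢ + y / μⱼ = t` is the time spent on the two legs of the characteristic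
    have e : x / S.lam i + y / S.mu j' = t := by
      rw [hydef]; field_simp; ring
    have h1 : c * (x / S.lam i) ≤ x := by
      rw [mul_div_assoc', div_le_iff₀ hli]; nlinarith [hl i, hx.1]
    have h2 : c * (y / S.mu j') ≤ y := by
      rw [mul_div_assoc', div_le_iff₀ hmj]; nlinarith [hm j', hy.1]
    have h3 : c * t ≤ x + y := by rw [← e, mul_add]; exact add_le_add h1 h2
    nlinarith [mul_le_mul_of_nonneg_left h3 hν]
  · exact absurd rfl hkl
  · simp only [weight, speed, slope, one_mul, ← Real.exp_add, Real.exp_le_exp]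
    nlinarith [mul_nonneg (mul_nonneg hν ht) (sub_nonneg.2 (hm j))]

/-! ### The right-hand sides -/

/-- The operator `B` is given by the right-hand sides of the system, with convergent integrals. -/
def IsSourceOp (B : State n m →L[ℝ] State n m) : Prop :=
  ∀ w, ∀ᵐ x ∂unitVol,
    (∀ i l, IntervalIntegrable (fun ξ => S.Cp x ξ i l * w (Sum.inl l) ξ) volume 0 x) ∧
    (∀ i j, IntervalIntegrable (fun ξ => S.Cm x ξ i j * w (Sum.inr j) ξ) volume 0 x) ∧
    (∀ i, B w (Sum.inl i) x
      = ∑ l, S.Spp i l * w (Sum.inl l) x + ∑ j, S.Spm i j * w (Sum.inr j) x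
        + ∑ l, (∫ ξ in (0 : ℝ)..x, S.Cp x ξ i l * w (Sum.inl l) ξ)
        + ∑ j, ∫ ξ in (0 : ℝ)..x, S.Cm x ξ i j * w (Sum.inr j) ξ) ∧
    ∀ j, B w (Sum.inr j) x = ∑ l, S.Om x j l * w (Sum.inr l) x

/-- The right-hand sides of the system form a bounded operator on the state. Its weighted norm is
bounded uniformly in `ν ≥ 0`: in the `α`-equation the weight `e^{-νx}` at `x` is at most the weights
at all `ξ ≤ x`, and the `β`-equation involves `β` at `x` only. -/
theorem exists_sourceOp : ∃ B : State n m →L[ℝ] State n m,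
    S.IsSourceOp B ∧
    ∃ b : ℝ, 0 ≤ b ∧ ∀ ν, 0 ≤ ν → ∀ w, ‖weightOp ν (B w)‖ ≤ b * ‖weightOp ν w‖ := by
  choose Vp hVp Mp hMp hVpw using fun i l => exists_volterra (k := fun x ξ => S.Cp x ξ i l) (S.Cp_bdd i l)
  choose Vm hVm Mm hMm hVmw using fun i l => exists_volterra (k := fun x ξ => S.Cm x ξ i l) (S.Cm_bdd i l)
  let A : Fin n ⊕ Fin m → Fin n ⊕ Fin m → L2s →L[ℝ] L2s := fun k l =>
    match k, l with
    | Sum.inl i, Sum.inl l => S.Spp i l • ContinuousLinearMap.id ℝ L2s + Vp i l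
    | Sum.inl i, Sum.inr j => S.Spm i j • ContinuousLinearMap.id ℝ L2s + Vm i j
    | Sum.inr _, Sum.inl _ => 0
    | Sum.inr j, Sum.inr l => mulOp fun x => S.Om x j l
  have hA : ∀ k l, ∃ b : ℝ, 0 ≤ b ∧ ∀ ν, 0 ≤ ν → ∀ f : L2s,
      ‖mulOp (weight (n := n) (m := m) ν k) (A k l f)‖
        ≤ b * ‖mulOp (weight (n := n) (m := m) ν l) f‖ := by
    have key : ∀ (s M : ℝ) (V : L2s →L[ℝ] L2s) (k l : Fin n ⊕ Fin m), 0 ≤ M →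
        (∀ w₁ w₂ : ℝ → ℝ, MemLp w₁ ⊤ unitVol → MemLp w₂ ⊤ unitVol →
          (∀ x ξ : ℝ, 0 ≤ ξ → ξ ≤ x → x ≤ 1 → |w₁ x| ≤ |w₂ ξ|) →
          ∀ f, ‖mulOp w₁ (V f)‖ ≤ M * ‖mulOp w₂ f‖) →
        (∀ ν x ξ : ℝ, 0 ≤ ν → 0 ≤ ξ → ξ ≤ x → x ≤ 1 → weight ν k x ≤ weight ν l ξ) →
        ∃ b : ℝ, 0 ≤ b ∧ ∀ ν, 0 ≤ ν → ∀ f : L2s,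
          ‖mulOp (weight ν k) ((s • ContinuousLinearMap.id ℝ L2s + V) f)‖
            ≤ b * ‖mulOp (weight ν l) f‖ := by
      intro s M V k l hM hV hkl
      refine ⟨|s| + M, by positivity, fun ν hν f => ?_⟩
      have hw : ∀ x ξ : ℝ, 0 ≤ ξ → ξ ≤ x → x ≤ 1 → |weight ν k x| ≤ |weight ν l ξ| := by
        intro x ξ h1 h2 h3
        rw [abs_of_pos (weight_pos _ _ _), abs_of_pos (weight_pos _ _ _)]
        exact hkl ν x ξ hν h1 h2 h3
      rw [_root_.add_apply, map_add, add_mul, _root_.smul_apply,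
        ContinuousLinearMap.id_apply, map_smul]
      refine (norm_add_le _ _).trans (add_le_add ?_ ?_)
      · rw [norm_smul, Real.norm_eq_abs]
        gcongr
        exact norm_mulOp_mono (memLp_weight ν k) (memLp_weight ν l)
          (fun x hx => hw x x hx.1 le_rfl hx.2) f
      · exact hV _ _ (memLp_weight ν k) (memLp_weight ν l) hw f
    rintro (i | j) (l | l)
    · refine key _ _ _ (Sum.inl i) (Sum.inl l) (hMp i l) (hVpw i l)
        fun ν x ξ hν h1 h2 h3 => Real.exp_le_exp.2 ?_
      nlinarith
    · refine key _ _ _ (Sum.inl i) (Sum.inr l) (hMm i l) (hVmw i l)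
        fun ν x ξ hν h1 h2 h3 => Real.exp_le_exp.2 ?_
      nlinarith
    · exact ⟨0, le_rfl, fun ν _ f => by simp [A]⟩
    · refine ⟨‖mulOp fun x => S.Om x j l‖, norm_nonneg _, fun ν _ f => ?_⟩
      rw [show A (Sum.inr j) (Sum.inr l) = mulOp fun x => S.Om x j l from rfl,
        mulOp_comm (memLp_weight ν _) (S.Om_bdd j l)]
      exact ContinuousLinearMap.le_opNorm _ _
  choose b hb hbw using hA
  refine ⟨opMatrix A, fun w => ?_, ∑ k, ∑ l, b k l,
    Finset.sum_nonneg fun k _ => Finset.sum_nonneg fun l _ => hb k l,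
    fun ν hν w => norm_opDiag_opMatrix_le hb (fun k l f => hbw k l ν hν f) w⟩
  have hsum : ∀ k, ∀ᵐ x ∂unitVol, opMatrix A w k x = ∑ l, A k l (w l) x := fun k => by
    rw [opMatrix_apply]
    filter_upwards [Lp.coeFn_finsetSum (p := 2) (μ := unitVol) Finset.univ fun l => A k l (w l)] with x hx
    rw [hx, Finset.sum_apply]
  have hid : ∀ (s : ℝ) (V : L2s →L[ℝ] L2s) (f : L2s), ∀ᵐ x ∂unitVol,
      (s • ContinuousLinearMap.id ℝ L2s + V) f x = s * f x + V f x := fun s V f => by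
    filter_upwards [Lp.coeFn_add (s • f) (V f), Lp.coeFn_smul s f] with x h1 h2
    change (s • f + V f : L2s) x = _
    rw [h1, Pi.add_apply, h2, Pi.smul_apply, smul_eq_mul]
  filter_upwards [ae_all_iff.2 hsum,
    ae_all_iff.2 fun i => ae_all_iff.2 fun l => hVp i l (w (Sum.inl l)),
    ae_all_iff.2 fun i => ae_all_iff.2 fun l => hVm i l (w (Sum.inr l)),
    ae_all_iff.2 fun i => ae_all_iff.2 fun l => hid (S.Spp i l) (Vp i l) (w (Sum.inl l)),
    ae_all_iff.2 fun i => ae_all_iff.2 fun l => hid (S.Spm i l) (Vm i l) (w (Sum.inr l)),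
    ae_all_iff.2 fun j => ae_all_iff.2 fun l => mulOp_ae (S.Om_bdd j l) (w (Sum.inr l)),
    Lp.coeFn_zero ℝ 2 unitVol]
    with x h1 h2 h3 h4 h5 h6 h7
  refine ⟨fun i l => (h2 i l).1, fun i l => (h3 i l).1, fun i => ?_, fun j => ?_⟩
  · rw [h1, Fintype.sum_sum_type]
    simp only [A, h4, h5, Finset.sum_add_distrib, (h2 _ _).2, (h3 _ _).2]
    ring
  · rw [h1, Fintype.sum_sum_type]
    simp only [A, h6, _root_.zero_apply, h7, Pi.zero_apply, Finset.sum_const_zero,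
      zero_add]

end TargetSystem

/-! ### The weak identity for the free transport -/

theorem hasDerivAt_uncurry_left {φ : ℝ → ℝ → ℝ} (hφ : ContDiff ℝ 1 (Function.uncurry φ)) (t x : ℝ) :
    HasDerivAt (fun r => φ r x) (fderiv ℝ (Function.uncurry φ) (t, x) (1, 0)) t := by
  have h1 : HasDerivAt (fun r : ℝ => (r, x)) ((1 : ℝ), (0 : ℝ)) t :=
    (hasDerivAt_id t).prodMk (hasDerivAt_const t x)
  have h2 : HasFDerivAt (Function.uncurry φ) (fderiv ℝ (Function.uncurry φ) (t, x))
      ((fun r : ℝ => (r, x)) t) := ((hφ.differentiable one_ne_zero) (t, x)).hasFDerivAt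
  exact h2.comp_hasDerivAt t h1

theorem hasDerivAt_uncurry_right {φ : ℝ → ℝ → ℝ} (hφ : ContDiff ℝ 1 (Function.uncurry φ))
    (t x : ℝ) : HasDerivAt (φ t) (fderiv ℝ (Function.uncurry φ) (t, x) (0, 1)) x := by
  have h1 : HasDerivAt (fun y : ℝ => (t, y)) ((0 : ℝ), (1 : ℝ)) x :=
    (hasDerivAt_const x t).prodMk (hasDerivAt_id x)
  have h2 : HasFDerivAt (Function.uncurry φ) (fderiv ℝ (Function.uncurry φ) (t, x))
      ((fun y : ℝ => (t, y)) x) := ((hφ.differentiable one_ne_zero) (t, x)).hasFDerivAt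
  exact h2.comp_hasDerivAt x h1

/-- The derivative of `φ` along the vector field `∂ₜ + σ ∂ₓ`. -/
def transportDeriv (σ : ℝ) (φ : ℝ → ℝ → ℝ) (t x : ℝ) : ℝ :=
  deriv (fun r => φ r x) t + σ * deriv (φ t) x

theorem transportDeriv_eq {φ : ℝ → ℝ → ℝ} (hφ : ContDiff ℝ 1 (Function.uncurry φ)) (σ t x : ℝ) :
    transportDeriv σ φ t x = fderiv ℝ (Function.uncurry φ) (t, x) (1, σ) := by
  rw [transportDeriv, (hasDerivAt_uncurry_left hφ t x).deriv,
    (hasDerivAt_uncurry_right hφ t x).deriv, ← smul_eq_mul, ← map_smul, ← map_add]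
  simp

theorem continuous_transportDeriv {φ : ℝ → ℝ → ℝ} (hφ : ContDiff ℝ 1 (Function.uncurry φ))
    (σ : ℝ) : Continuous (Function.uncurry (transportDeriv σ φ)) := by
  have h : Function.uncurry (transportDeriv σ φ)
      = fun q => fderiv ℝ (Function.uncurry φ) q (1, σ) := by
    funext q; exact transportDeriv_eq hφ σ q.1 q.2
  rw [h]
  exact (hφ.continuous_fderiv one_ne_zero).clm_apply continuous_const

theorem continuous_section {φ : ℝ → ℝ → ℝ} (hφ : Continuous (Function.uncurry φ)) (t : ℝ) :
    Continuous (φ t) :=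
  hφ.comp (Continuous.prodMk continuous_const continuous_id)

/-- Integration by parts along the characteristics of speed `σ`: the divergence theorem on
`[s,T] × [0,1]` for the vector field `(1, σ) A(x - σ(t-s)) φ(t,x)`. -/
theorem integral_transport {A : ℝ → ℝ} (hA : ContDiff ℝ 1 A) {φ : ℝ → ℝ → ℝ}
    (hφ : ContDiff ℝ 1 (Function.uncurry φ)) (σ s T : ℝ) :
    ∫ x in (0 : ℝ)..1, A (x - σ * (T - s)) * φ T x
      = (∫ x in (0 : ℝ)..1, A x * φ s x)
        + (∫ t in s..T, ∫ x in (0 : ℝ)..1, A (x - σ * (t - s)) * transportDeriv σ φ t x)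
        + ∫ t in s..T, σ * (A (0 - σ * (t - s)) * φ t 0 - A (1 - σ * (t - s)) * φ t 1) := by
  set f : ℝ × ℝ → ℝ := fun q => A (q.2 - σ * (q.1 - s)) * Function.uncurry φ q with hf
  have hin : ContDiff ℝ 1 fun q : ℝ × ℝ => A (q.2 - σ * (q.1 - s)) := hA.comp (by fun_prop)
  have hfc : ContDiff ℝ 1 f := hin.mul hφ
  have hfd : ∀ q, HasFDerivAt f (fderiv ℝ f q) q := fun q =>
    ((hfc.differentiable one_ne_zero) q).hasFDerivAt
  have hdir : ∀ q, fderiv ℝ f q (1, 0) + (σ • fderiv ℝ f q) (0, 1)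
      = A (q.2 - σ * (q.1 - s)) * transportDeriv σ φ q.1 q.2 := by
    intro q
    have e1 : fderiv ℝ f q (1, 0) + (σ • fderiv ℝ f q) (0, 1) = fderiv ℝ f q (1, σ) := by
      rw [_root_.smul_apply, ← map_smul, ← map_add]; simp
    have hA' := ((hA.differentiable one_ne_zero) (q.2 - σ * (q.1 - s))).hasDerivAt
    have h2 : HasFDerivAt (fun q : ℝ × ℝ => q.2 - σ * (q.1 - s))
        (ContinuousLinearMap.snd ℝ ℝ ℝ - σ • ContinuousLinearMap.fst ℝ ℝ ℝ) q := by
      have := (hasFDerivAt_snd (𝕜 := ℝ) (p := q)).sub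
        (((hasFDerivAt_fst (𝕜 := ℝ) (p := q)).sub_const s).const_mul σ)
      exact this
    have h3 := (hA'.comp_hasFDerivAt q h2).mul
      (((hφ.differentiable one_ne_zero) q).hasFDerivAt)
    have h4 : HasFDerivAt f _ q := h3
    rw [e1, h4.fderiv, transportDeriv_eq hφ]
    simp
  have hdiv := integral2_divergence_prod_of_hasFDerivAt f (fun q => σ * f q) (fderiv ℝ f)
    (fun q => σ • fderiv ℝ f q) s 0 T 1 hfc.continuous.continuousOn
    (continuous_const.mul hfc.continuous).continuousOn (fun q _ => hfd q)
    (fun q _ => (hfd q).const_mul σ)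
    (by
      simp_rw [hdir]
      refine ContinuousOn.integrableOn_compact (isCompact_uIcc.prod isCompact_uIcc)
        (Continuous.continuousOn ?_)
      exact hin.continuous.mul (continuous_transportDeriv hφ σ))
  simp_rw [hdir] at hdiv
  have c1 : ∀ y, Continuous fun t => σ * f (t, y) := fun y =>
    continuous_const.mul (hfc.continuous.comp (by fun_prop))
  rw [← intervalIntegral.integral_sub ((c1 1).intervalIntegrable _ _)
    ((c1 0).intervalIntegrable _ _)] at hdiv
  simp only [hf, Function.uncurry_apply_pair, sub_self, mul_zero, sub_zero] at hdiv
  rw [hdiv]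
  have e : ∫ t in s..T, σ * (A (0 - σ * (t - s)) * φ t 0 - A (1 - σ * (t - s)) * φ t 1)
      = -∫ t in s..T, (σ * (A (1 - σ * (t - s)) * φ t 1) - σ * (A (0 - σ * (t - s)) * φ t 0)) := by
    rw [← intervalIntegral.integral_neg]
    refine intervalIntegral.integral_congr fun t _ => ?_
    ring
  rw [e]
  ring

theorem toL2s_sum {ι : Type*} [Fintype ι] {c : ι → ℝ} {f : ι → ℝ → ℝ}
    (hf : ∀ l, Continuous (f l)) :
    ∑ l, c l • toL2s (f l) = toL2s fun x => ∑ l, c l * f l x := by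
  have hc : Continuous fun x => ∑ l, c l * f l x :=
    continuous_finsetSum _ fun l _ => continuous_const.mul (hf l)
  refine Lp.ext ?_
  filter_upwards [Lp.coeFn_finsetSum (p := 2) (μ := unitVol) Finset.univ fun l => c l • toL2s (f l),
    coeFn_toL2s_of_continuous hc, ae_all_iff.2 fun l => Lp.coeFn_smul (c l) (toL2s (f l)),
    ae_all_iff.2 fun l => coeFn_toL2s_of_continuous (hf l)] with x h1 h2 h3 h4
  rw [h1, h2, Finset.sum_apply]
  refine Finset.sum_congr rfl fun l _ => ?_
  rw [h3, Pi.smul_apply, h4, smul_eq_mul]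

namespace TargetSystem

variable (S : TargetSystem n m)

/-- Test functions, by scalar components, that are `C¹` and satisfy the adjoint boundary conditions
on `[0,T]`. -/
structure IsScalarTest (T : ℝ) (F : Fin n ⊕ Fin m → ℝ → ℝ → ℝ) : Prop where
  contDiff : ∀ k, ContDiff ℝ 1 (Function.uncurry (F k))
  at_one : ∀ t ∈ Icc 0 T, ∀ i, F (Sum.inl i) t 1 = 0
  at_zero : ∀ t ∈ Icc 0 T, ∀ j,
    S.mu j * F (Sum.inr j) t 0 = ∑ i, S.Q0 i j * (S.lam i * F (Sum.inl i) t 0)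

/-- The curve in the state space of a family of test functions. -/
def testCurve (F : Fin n ⊕ Fin m → ℝ → ℝ → ℝ) (t : ℝ) : State n m := fun k => toL2s (F k t)

/-- The adjoint transport operator applied to a family of test functions. -/
def adjointCurve (F : Fin n ⊕ Fin m → ℝ → ℝ → ℝ) (t : ℝ) : State n m :=
  fun k => toL2s (transportDeriv (S.speed k) (F k) t)

variable {S} in
theorem IsScalarTest.continuous_testCurve {T : ℝ} {F : Fin n ⊕ Fin m → ℝ → ℝ → ℝ}
    (hF : S.IsScalarTest T F) : Continuous (testCurve F) :=
  continuous_pi fun k => continuous_toL2s (hF.contDiff k).continuous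

variable {S} in
theorem IsScalarTest.continuous_adjointCurve {T : ℝ} {F : Fin n ⊕ Fin m → ℝ → ℝ → ℝ}
    (hF : S.IsScalarTest T F) : Continuous (S.adjointCurve F) :=
  continuous_pi fun k => continuous_toL2s (continuous_transportDeriv (hF.contDiff k) _)

/-- The profile on the line that is translated with speed `speed k` to give the component `k` of the
free transport. -/
def profile (g : Fin n ⊕ Fin m → ℝ → ℝ) (k : Fin n ⊕ Fin m) (x : ℝ) : ℝ :=
  ∑ l, S.coeff k l * g l (S.slope k l * x)

theorem contDiff_profile {g : Fin n ⊕ Fin m → ℝ → ℝ} (hg : ∀ l, IsBump (g l))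
    (k : Fin n ⊕ Fin m) : ContDiff ℝ 1 (S.profile g k) := by
  unfold profile
  exact ContDiff.sum fun l _ => contDiff_const.mul ((hg l).1.comp (by fun_prop))

theorem transport_bump {g : Fin n ⊕ Fin m → ℝ → ℝ} (hg : ∀ l, IsBump (g l)) (t : ℝ)
    (k : Fin n ⊕ Fin m) :
    S.transport t (fun l => toL2s (g l)) k = toL2s fun x => S.profile g k (x - S.speed k * t) := by
  rw [transport_apply]
  simp_rw [fun l => pullback_toL2s (S.slope_ne_zero k l) (S.speed k * t) (hg l)]
  exact toL2s_sum (c := S.coeff k) (f := fun l x => g l (S.slope k l * (x - S.speed k * t)))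
    fun l => (hg l).continuous.comp (by fun_prop)

theorem profile_inl (g : Fin n ⊕ Fin m → ℝ → ℝ) (i : Fin n) (x : ℝ) :
    S.profile g (Sum.inl i) x
      = g (Sum.inl i) x + ∑ j, S.Q0 i j * g (Sum.inr j) (-(S.mu j / S.lam i) * x) := by
  simp [profile, Fintype.sum_sum_type, coeff, slope]

theorem profile_inr (g : Fin n ⊕ Fin m → ℝ → ℝ) (j : Fin m) (x : ℝ) :
    S.profile g (Sum.inr j) x = g (Sum.inr j) x := by
  simp [profile, Fintype.sum_sum_type, coeff, slope]

theorem profile_of_mem {g : Fin n ⊕ Fin m → ℝ → ℝ} (hg : ∀ l, IsBump (g l)) (k : Fin n ⊕ Fin m)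
    {x : ℝ} (hx : x ∈ Icc (0 : ℝ) 1) : S.profile g k x = g k x := by
  rcases k with i | j
  · rw [profile_inl, Finset.sum_eq_zero fun j _ => ?_, add_zero]
    rw [(hg _).2 _ fun h => ?_, mul_zero]
    have h1 : 0 ≤ S.mu j / S.lam i := (div_pos (S.mu_pos j) (S.lam_pos i)).le
    nlinarith [h.1, mul_nonneg h1 hx.1]
  · exact S.profile_inr g j x

/-- The boundary terms of the free transport and of an admissible test function cancel. -/
theorem boundary_terms_cancel {T : ℝ} {F : Fin n ⊕ Fin m → ℝ → ℝ → ℝ} (hF : S.IsScalarTest T F)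
    {g : Fin n ⊕ Fin m → ℝ → ℝ} (hg : ∀ l, IsBump (g l)) {t τ : ℝ} (ht : t ∈ Icc 0 T)
    (hτ : 0 ≤ τ) :
    ∑ k, S.speed k * (S.profile g k (0 - S.speed k * τ) * F k t 0
      - S.profile g k (1 - S.speed k * τ) * F k t 1) = 0 := by
  have h0 : ∀ k x, x ≤ 0 → g k x = 0 := fun k x hx => (hg k).2 x fun h => by linarith [h.1]
  have h1 : ∀ k x, 1 ≤ x → g k x = 0 := fun k x hx => (hg k).2 x fun h => by linarith [h.2]
  rw [Fintype.sum_sum_type]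
  have e1 : ∀ i, S.speed (Sum.inl i) * (S.profile g (Sum.inl i) (0 - S.speed (Sum.inl i) * τ)
      * F (Sum.inl i) t 0 - S.profile g (Sum.inl i) (1 - S.speed (Sum.inl i) * τ)
      * F (Sum.inl i) t 1)
      = ∑ j, g (Sum.inr j) (S.mu j * τ) * (S.Q0 i j * (S.lam i * F (Sum.inl i) t 0)) := by
    intro i
    have hl := S.lam_pos i
    rw [hF.at_one t ht i, profile_inl, h0 (Sum.inl i) _ (by
      simp only [speed]; nlinarith), zero_add, mul_zero, sub_zero, Finset.sum_mul, Finset.mul_sum]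
    refine Finset.sum_congr rfl fun j _ => ?_
    have : -(S.mu j / S.lam i) * (0 - S.speed (Sum.inl i) * τ) = S.mu j * τ := by
      simp only [speed]; field_simp; ring
    rw [this, speed]
    ring
  have e2 : ∀ j, S.speed (Sum.inr j) * (S.profile g (Sum.inr j) (0 - S.speed (Sum.inr j) * τ)
      * F (Sum.inr j) t 0 - S.profile g (Sum.inr j) (1 - S.speed (Sum.inr j) * τ)
      * F (Sum.inr j) t 1)
      = -(g (Sum.inr j) (S.mu j * τ) * ∑ i, S.Q0 i j * (S.lam i * F (Sum.inl i) t 0)) := by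
    intro j
    have hm := S.mu_pos j
    rw [profile_inr, profile_inr, h1 (Sum.inr j) (1 - S.speed (Sum.inr j) * τ) (by
      simp only [speed]; nlinarith), ← hF.at_zero t ht j]
    simp only [speed]
    rw [show (0 : ℝ) - -S.mu j * τ = S.mu j * τ by ring]
    ring
  simp_rw [e1, e2]
  rw [Finset.sum_comm, ← Finset.sum_add_distrib]
  refine Finset.sum_eq_zero fun j _ => ?_
  rw [Finset.mul_sum, add_neg_cancel]

theorem transport_weak_bump {T : ℝ} {F : Fin n ⊕ Fin m → ℝ → ℝ → ℝ} (hF : S.IsScalarTest T F)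
    {s : ℝ} (hs : 0 ≤ s) (hsT : s ≤ T) {g : Fin n ⊕ Fin m → ℝ → ℝ} (hg : ∀ l, IsBump (g l)) :
    pairing (testCurve F T) (S.transport (T - s) fun k => toL2s (g k))
      = pairing (testCurve F s) (fun k => toL2s (g k))
        + ∫ t in s..T, pairing (S.adjointCurve F t) (S.transport (t - s) fun k => toL2s (g k)) := by
  have hpc : ∀ k, Continuous (S.profile g k) := fun k => (S.contDiff_profile hg k).continuous
  have hps : ∀ k τ, Continuous fun x => S.profile g k (x - S.speed k * τ) := fun k τ =>
    (hpc k).comp (continuous_id.sub continuous_const)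
  have hFc : ∀ k t, Continuous (F k t) := fun k t => continuous_section (hF.contDiff k).continuous t
  have hLc : ∀ k t, Continuous (transportDeriv (S.speed k) (F k) t) := fun k t =>
    continuous_section (continuous_transportDeriv (hF.contDiff k) _) t
  have l1 : pairing (testCurve F T) (S.transport (T - s) fun k => toL2s (g k))
      = ∑ k, ∫ x in (0 : ℝ)..1, S.profile g k (x - S.speed k * (T - s)) * F k T x := by
    rw [pairing_apply]
    refine Finset.sum_congr rfl fun k _ => ?_
    rw [S.transport_bump hg, real_inner_comm, testCurve,
      inner_toL2s_toL2s (hps k _) (hFc k T)]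
  have l2 : pairing (testCurve F s) (fun k => toL2s (g k))
      = ∑ k, ∫ x in (0 : ℝ)..1, S.profile g k x * F k s x := by
    rw [pairing_apply]
    refine Finset.sum_congr rfl fun k _ => ?_
    rw [real_inner_comm, testCurve, inner_toL2s_toL2s (hg k).continuous (hFc k s)]
    refine intervalIntegral.integral_congr fun x hx => ?_
    rw [uIcc_of_le zero_le_one] at hx
    simp only [S.profile_of_mem hg k hx]
  have l3 : ∀ t, pairing (S.adjointCurve F t) (S.transport (t - s) fun k => toL2s (g k))
      = ∑ k, ∫ x in (0 : ℝ)..1, S.profile g k (x - S.speed k * (t - s))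
          * transportDeriv (S.speed k) (F k) t x := by
    intro t
    rw [pairing_apply]
    refine Finset.sum_congr rfl fun k _ => ?_
    rw [S.transport_bump hg, real_inner_comm, adjointCurve,
      inner_toL2s_toL2s (hps k _) (hLc k t)]
  have c3 : ∀ k, Continuous fun t => ∫ x in (0 : ℝ)..1, S.profile g k (x - S.speed k * (t - s))
      * transportDeriv (S.speed k) (F k) t x := fun k => by
    refine intervalIntegral.continuous_parametric_intervalIntegral_of_continuous' (f := fun t x =>
      S.profile g k (x - S.speed k * (t - s)) * transportDeriv (S.speed k) (F k) t x) ?_ _ _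
    exact ((hpc k).comp (by fun_prop)).mul (continuous_transportDeriv (hF.contDiff k) _)
  have c4 : ∀ k, Continuous fun t => S.speed k *
      (S.profile g k (0 - S.speed k * (t - s)) * F k t 0
        - S.profile g k (1 - S.speed k * (t - s)) * F k t 1) := fun k => by
    have hf : ∀ y, Continuous fun t => F k t y := fun y =>
      (hF.contDiff k).continuous.comp (Continuous.prodMk continuous_id continuous_const)
    exact continuous_const.mul ((((hpc k).comp (by fun_prop)).mul (hf 0)).sub
      (((hpc k).comp (by fun_prop)).mul (hf 1)))
  have hbd : ∑ k, ∫ t in s..T, S.speed k *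
      (S.profile g k (0 - S.speed k * (t - s)) * F k t 0
        - S.profile g k (1 - S.speed k * (t - s)) * F k t 1) = 0 := by
    rw [← intervalIntegral.integral_finsetSum fun k _ => (c4 k).intervalIntegrable _ _]
    rw [intervalIntegral.integral_congr (g := fun _ => (0 : ℝ)) fun t ht => ?_]
    · simp
    · rw [uIcc_of_le hsT] at ht
      exact S.boundary_terms_cancel hF hg ⟨hs.trans ht.1, ht.2⟩ (sub_nonneg.2 ht.1)
  simp_rw [l3]
  rw [l1, l2, intervalIntegral.integral_finsetSum fun k _ => (c3 k).intervalIntegrable _ _,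
    Finset.sum_congr rfl fun k _ =>
      integral_transport (S.contDiff_profile hg k) (hF.contDiff k) (S.speed k) s T,
    Finset.sum_add_distrib, Finset.sum_add_distrib, hbd, add_zero]

theorem transport_weak {T : ℝ} {F : Fin n ⊕ Fin m → ℝ → ℝ → ℝ} (hF : S.IsScalarTest T F)
    {s : ℝ} (hs : 0 ≤ s) (hsT : s ≤ T) (w : State n m) :
    pairing (testCurve F T) (S.transport (T - s) w)
      = pairing (testCurve F s) w
        + ∫ t in s..T, pairing (S.adjointCurve F t) (S.transport (t - s) w) := by
  have hd : Dense (Set.pi univ fun _ : Fin n ⊕ Fin m => {f : L2s | ∃ g, IsBump g ∧ f = toL2s g}) :=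
    dense_pi _ fun _ _ => dense_bump
  have htr : Continuous fun q : State n m × ℝ => S.transport (q.2 - s) q.1 := by
    have h0 : Continuous fun q : State n m × ℝ => ((q.2 - s, q.1) : ℝ × State n m) := by fun_prop
    have h1 := S.continuous_transport.comp h0
    exact h1
  have hPt : Continuous fun q : State n m × ℝ =>
      pairing (S.adjointCurve F q.2) (S.transport (q.2 - s) q.1) := by
    have h0 := (hF.continuous_adjointCurve.comp continuous_snd).prodMk htr
    have h1 := continuous_pairing.comp h0
    exact h1
  have hint : Continuous fun w : State n m =>
      ∫ t in s..T, pairing (S.adjointCurve F t) (S.transport (t - s) w) :=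
    intervalIntegral.continuous_parametric_intervalIntegral_of_continuous'
      (f := fun w t => pairing (S.adjointCurve F t) (S.transport (t - s) w)) hPt _ _
  have hl : Continuous fun w : State n m => pairing (testCurve F T) (S.transport (T - s) w) := by
    have h1 := (pairing (testCurve F T)).continuous.comp (S.transport (T - s)).continuous
    exact h1
  have hr := (pairing (testCurve F s)).continuous.add hint
  have hall := Continuous.ext_on hd hl hr fun w hw => by
    choose g hg hgw using fun k => hw k (mem_univ k)
    obtain rfl : w = fun k => toL2s (g k) := funext hgw
    exact S.transport_weak_bump hF hs hsT hg
  exact congrFun hall w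

end TargetSystem

/-! ### Uniqueness for the free transport -/

namespace TargetSystem

variable (S : TargetSystem n m)

/-- The profile on the line whose translates solve the adjoint transport problem: `ψⱼ` is extended
to `x < 0` so as to satisfy the adjoint boundary condition at `x = 0`. -/
def adjointProfile (g : Fin n ⊕ Fin m → ℝ → ℝ) : Fin n ⊕ Fin m → ℝ → ℝ
  | Sum.inl i, y => g (Sum.inl i) y
  | Sum.inr j, y => g (Sum.inr j) y
      + ∑ i, (S.mu j)⁻¹ * (S.Q0 i j * (S.lam i * g (Sum.inl i) (-(S.lam i / S.mu j) * y)))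

/-- The solution of the adjoint transport problem with final value `g` at time `T`. -/
def adjointSolution (T : ℝ) (g : Fin n ⊕ Fin m → ℝ → ℝ) (k : Fin n ⊕ Fin m) (t x : ℝ) : ℝ :=
  S.adjointProfile g k (x + S.speed k * (T - t))

theorem contDiff_adjointProfile {g : Fin n ⊕ Fin m → ℝ → ℝ} (hg : ∀ l, IsBump (g l))
    (k : Fin n ⊕ Fin m) : ContDiff ℝ 1 (S.adjointProfile g k) := by
  rcases k with i | j
  · exact (hg (Sum.inl i)).1
  · refine (hg (Sum.inr j)).1.add (ContDiff.sum fun i _ => ?_)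
    exact contDiff_const.mul (contDiff_const.mul (contDiff_const.mul
      ((hg (Sum.inl i)).1.comp (by fun_prop))))

theorem isScalarTest_adjointSolution (T : ℝ) {g : Fin n ⊕ Fin m → ℝ → ℝ} (hg : ∀ l, IsBump (g l)) :
    S.IsScalarTest T (S.adjointSolution T g) where
  contDiff k := (S.contDiff_adjointProfile hg k).comp
    (f := fun q : ℝ × ℝ => q.2 + S.speed k * (T - q.1)) (by fun_prop)
  at_one t ht i := by
    refine (hg (Sum.inl i)).2 _ fun h => ?_
    have h1 := h.2
    simp only [speed] at h1
    nlinarith [S.lam_pos i, ht.2]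
  at_zero t ht j := by
    have hm := S.mu_pos j
    simp only [adjointSolution, adjointProfile, speed]
    rw [(hg (Sum.inr j)).2 _ fun h => by nlinarith [h.1, ht.2], zero_add, Finset.mul_sum]
    refine Finset.sum_congr rfl fun i _ => ?_
    have e : -(S.lam i / S.mu j) * (0 + -S.mu j * (T - t)) = 0 + S.lam i * (T - t) := by
      field_simp
      ring
    rw [e, mul_inv_cancel_left₀ hm.ne']

theorem transportDeriv_adjointSolution (T : ℝ) {g : Fin n ⊕ Fin m → ℝ → ℝ}
    (hg : ∀ l, IsBump (g l)) (k : Fin n ⊕ Fin m) (t x : ℝ) :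
    transportDeriv (S.speed k) (S.adjointSolution T g k) t x = 0 := by
  have hd := ((S.contDiff_adjointProfile hg k).differentiable one_ne_zero
    (x + S.speed k * (T - t))).hasDerivAt
  have h1 : HasDerivAt (fun r => x + S.speed k * (T - r)) (-S.speed k) t := by
    simpa using (((hasDerivAt_id t).const_sub T).const_mul (S.speed k)).const_add x
  have h2 : HasDerivAt (fun y => y + S.speed k * (T - t)) 1 x := (hasDerivAt_id x).add_const _
  have e1 : HasDerivAt (fun r => S.adjointSolution T g k r x) _ t := hd.comp t h1
  have e2 : HasDerivAt (S.adjointSolution T g k t) _ x := hd.comp x h2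
  rw [transportDeriv, e1.deriv, e2.deriv]
  ring

theorem adjointProfile_of_mem {g : Fin n ⊕ Fin m → ℝ → ℝ} (hg : ∀ l, IsBump (g l))
    (k : Fin n ⊕ Fin m) {x : ℝ} (hx : x ∈ Icc (0 : ℝ) 1) : S.adjointProfile g k x = g k x := by
  rcases k with i | j
  · rfl
  · rw [adjointProfile, Finset.sum_eq_zero fun i _ => ?_, add_zero]
    rw [(hg (Sum.inl i)).2 _ fun h => ?_, mul_zero, mul_zero, mul_zero]
    have h1 : 0 ≤ S.lam i / S.mu j := (div_pos (S.lam_pos i) (S.mu_pos j)).le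
    nlinarith [h.1, mul_nonneg h1 hx.1]

/-- A curve that satisfies the weak identity of the free transport with zero data vanishes: it is
orthogonal to the final values of all solutions of the adjoint problem. -/
theorem eq_zero_of_weak {T : ℝ} {d : ℝ → State n m}
    (h : ∀ F, S.IsScalarTest T F →
      pairing (testCurve F T) (d T) = ∫ t in (0 : ℝ)..T, pairing (S.adjointCurve F t) (d t)) :
    d T = 0 := by
  classical
  funext k₀
  refine eq_zero_of_inner_bump fun g hg => ?_
  set gs : Fin n ⊕ Fin m → ℝ → ℝ := fun k => if k = k₀ then g else fun _ => 0 with hgs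
  have hb : ∀ k, IsBump (gs k) := fun k => by
    by_cases hk : k = k₀
    · simp only [hgs, hk, if_true]; exact hg
    · simp only [hgs, hk, if_false]; exact isBump_zero
  have h1 := h _ (S.isScalarTest_adjointSolution T hb)
  have h2 : ∀ t, S.adjointCurve (S.adjointSolution T gs) t = 0 := fun t => by
    funext k
    refine Lp.ext ?_
    have e : transportDeriv (S.speed k) (S.adjointSolution T gs k) t = fun _ => 0 :=
      funext fun x => S.transportDeriv_adjointSolution T hb k t x
    rw [adjointCurve, e]
    filter_upwards [coeFn_toL2s_of_continuous (continuous_const (y := (0 : ℝ))),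
      Lp.coeFn_zero ℝ 2 unitVol] with x h3 h4
    rw [h3]; exact h4.symm
  have h3 : ∀ k, testCurve (S.adjointSolution T gs) T k = toL2s (gs k) := fun k => by
    refine toL2s_congr (continuous_section
      ((S.isScalarTest_adjointSolution T hb).contDiff k).continuous T) (hb k).continuous
      fun x hx => ?_
    rw [adjointSolution, sub_self, mul_zero, add_zero, S.adjointProfile_of_mem hb k hx]
  have h4 : toL2s (fun _ => 0) = 0 := by
    refine Lp.ext ?_
    filter_upwards [coeFn_toL2s_of_continuous (continuous_const (y := (0 : ℝ))),
      Lp.coeFn_zero ℝ 2 unitVol] with x h3 h4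
    rw [h3]; exact h4.symm
  have h5 : ∀ k, gs k = if k = k₀ then g else fun _ => 0 := fun k => rfl
  simp_rw [h2, pairing_apply] at h1
  rw [Finset.sum_eq_single k₀ (fun k _ hk => by rw [h3, h5, if_neg hk, h4, inner_zero_left])
    (fun hk => absurd (Finset.mem_univ _) hk), h3, h5, if_pos rfl] at h1
  rw [real_inner_comm, h1]
  simp

end TargetSystem

/-! ### Vector-valued and scalar components -/

/-- The scalar components of a pair of vector-valued `L²` functions. -/
def toState : L2 n × L2 m →L[ℝ] State n m :=
  ContinuousLinearMap.pi fun k => match k with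
    | Sum.inl i => ((EuclideanSpace.proj i : EuclideanSpace ℝ (Fin n) →L[ℝ] ℝ).compLpL 2
        unitVol).comp (ContinuousLinearMap.fst ℝ (L2 n) (L2 m))
    | Sum.inr j => ((EuclideanSpace.proj j : EuclideanSpace ℝ (Fin m) →L[ℝ] ℝ).compLpL 2
        unitVol).comp (ContinuousLinearMap.snd ℝ (L2 n) (L2 m))

theorem toState_inl_ae (p : L2 n × L2 m) (i : Fin n) :
    toState p (Sum.inl i) =ᵐ[unitVol] fun x => (p.1 x).ofLp i :=
  ContinuousLinearMap.coeFn_compLpL (p := 2) (μ := unitVol)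
    (EuclideanSpace.proj i : EuclideanSpace ℝ (Fin n) →L[ℝ] ℝ) p.1

theorem toState_inr_ae (p : L2 n × L2 m) (j : Fin m) :
    toState p (Sum.inr j) =ᵐ[unitVol] fun x => (p.2 x).ofLp j :=
  ContinuousLinearMap.coeFn_compLpL (p := 2) (μ := unitVol)
    (EuclideanSpace.proj j : EuclideanSpace ℝ (Fin m) →L[ℝ] ℝ) p.2

/-- The `L²` function with values in `ℝᵏ` that has the given scalar components. -/
def assemble (k : ℕ) : (Fin k → L2s) →L[ℝ] L2 k :=
  ∑ i, ((ContinuousLinearMap.toSpanSingleton ℝ (EuclideanSpace.single i (1 : ℝ))).compLpL 2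
    unitVol).comp (ContinuousLinearMap.proj i)

theorem assemble_ae {k : ℕ} (f : Fin k → L2s) :
    ∀ᵐ x ∂unitVol, ∀ i, (assemble k f x).ofLp i = f i x := by
  have e : assemble k f = ∑ i, (ContinuousLinearMap.toSpanSingleton ℝ
      (EuclideanSpace.single i (1 : ℝ))).compLpL 2 unitVol (f i) := by
    simp [assemble]
  rw [e]
  filter_upwards [Lp.coeFn_finsetSum (p := 2) (μ := unitVol) Finset.univ fun i =>
    (ContinuousLinearMap.toSpanSingleton ℝ
      (EuclideanSpace.single i (1 : ℝ) : EuclideanSpace ℝ (Fin k))).compLpL 2 unitVol (f i),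
    ae_all_iff.2 fun i => ContinuousLinearMap.coeFn_compLpL (p := 2) (μ := unitVol)
      (ContinuousLinearMap.toSpanSingleton ℝ
        (EuclideanSpace.single i (1 : ℝ) : EuclideanSpace ℝ (Fin k))) (f i)] with x h1 h2 i
  rw [h1, Finset.sum_apply]
  simp [h2, Pi.single_apply]

/-- The inverse of `toState`. -/
def ofState : State n m →L[ℝ] L2 n × L2 m :=
  ((assemble n).comp (ContinuousLinearMap.pi fun i => ContinuousLinearMap.proj (Sum.inl i))).prod
    ((assemble m).comp (ContinuousLinearMap.pi fun j => ContinuousLinearMap.proj (Sum.inr j)))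

theorem toState_ofState (w : State n m) : toState (ofState w) = w := by
  funext k
  refine Lp.ext ?_
  rcases k with i | j
  · filter_upwards [toState_inl_ae (ofState w) i, assemble_ae fun i => w (Sum.inl i)] with x h1 h2
    rw [h1]; exact h2 i
  · filter_upwards [toState_inr_ae (ofState w) j, assemble_ae fun j => w (Sum.inr j)] with x h1 h2
    rw [h1]; exact h2 j

theorem ofState_toState (p : L2 n × L2 m) : ofState (toState p) = p := by
  refine Prod.ext (Lp.ext ?_) (Lp.ext ?_)
  · filter_upwards [assemble_ae fun i => toState p (Sum.inl i),
      ae_all_iff.2 (toState_inl_ae p)] with x h1 h2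
    ext i
    exact (h1 i).trans (h2 i)
  · filter_upwards [assemble_ae fun j => toState p (Sum.inr j),
      ae_all_iff.2 (toState_inr_ae p)] with x h1 h2
    ext i
    exact (h1 i).trans (h2 i)

theorem l2Norm_le (p : L2 n × L2 m) :
    l2Norm p.1 p.2 ≤ 2 * ‖(ofState : State n m →L[ℝ] L2 n × L2 m)‖ * ‖toState p‖ := by
  have h1 : ‖p‖ ≤ ‖(ofState : State n m →L[ℝ] L2 n × L2 m)‖ * ‖toState p‖ := by
    conv_lhs => rw [← ofState_toState p]
    exact ContinuousLinearMap.le_opNorm _ _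
  have h2 : l2Norm p.1 p.2 ≤ 2 * ‖p‖ := by
    refine Real.sqrt_le_iff.2 ⟨by positivity, ?_⟩
    have h3 := norm_fst_le p
    have h4 := norm_snd_le p
    nlinarith [norm_nonneg p.1, norm_nonneg p.2, norm_nonneg p]
  linarith

theorem norm_toState_le (p : L2 n × L2 m) :
    ‖toState p‖ ≤ ‖(toState : L2 n × L2 m →L[ℝ] State n m)‖ * l2Norm p.1 p.2 := by
  refine (ContinuousLinearMap.le_opNorm _ _).trans ?_
  gcongr
  refine norm_prod_le_iff.2 ⟨?_, ?_⟩
  · exact Real.le_sqrt_of_sq_le (by nlinarith [sq_nonneg ‖p.2‖])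
  · exact Real.le_sqrt_of_sq_le (by nlinarith [sq_nonneg ‖p.1‖])

/-! ### The weak identity in terms of scalar components -/

theorem integrable_mul_continuous (a : L2s) {f : ℝ → ℝ} (hf : Continuous f) :
    Integrable (fun x => a x * f x) unitVol :=
  (Lp.memLp a).integrable_mul (memLp_of_continuous hf)

theorem pairing_toL2s {f : Fin n ⊕ Fin m → ℝ → ℝ} (hf : ∀ k, Continuous (f k)) (w : State n m) :
    pairing (fun k => toL2s (f k)) w = ∫ x, ∑ k, w k x * f k x ∂unitVol := by
  rw [pairing_apply, integral_finsetSum _ fun k _ => integrable_mul_continuous (w k) (hf k)]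
  refine Finset.sum_congr rfl fun k _ => ?_
  rw [real_inner_comm, inner_toL2s _ (hf k), integral_unitVol]

namespace TargetSystem

variable (S : TargetSystem n m)

/-- The scalar components of a pair of vector-valued test functions. -/
def components (φ : ℝ → ℝ → Fin n → ℝ) (ψ : ℝ → ℝ → Fin m → ℝ) : Fin n ⊕ Fin m → ℝ → ℝ → ℝ
  | Sum.inl i, t, x => φ t x i
  | Sum.inr j, t, x => ψ t x j

theorem isTest_iff {T : ℝ} {φ : ℝ → ℝ → Fin n → ℝ} {ψ : ℝ → ℝ → Fin m → ℝ} :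
    S.IsTest T φ ψ ↔ S.IsScalarTest T (components φ ψ) := by
  have hz : ∀ t, S.LamM *ᵥ ψ t 0 = S.Q0ᵀ *ᵥ (S.LamP *ᵥ φ t 0) ↔
      ∀ j, S.mu j * ψ t 0 j = ∑ i, S.Q0 i j * (S.lam i * φ t 0 i) := fun t => by
    rw [funext_iff]
    refine forall_congr' fun j => ?_
    have e : (S.Q0ᵀ *ᵥ (S.LamP *ᵥ φ t 0)) j = ∑ i, S.Q0 i j * (S.lam i * φ t 0 i) := by
      change ∑ i, S.Q0 i j * (S.LamP *ᵥ φ t 0) i = _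
      simp only [LamP, Matrix.mulVec_diagonal]
    rw [e, LamM, Matrix.mulVec_diagonal]
  constructor
  · intro h
    refine ⟨fun k => ?_, fun t ht i => congrFun (h.at_one t ht) i,
      fun t ht => (hz t).1 (h.at_zero t ht)⟩
    rcases k with i | j
    · exact contDiff_pi.1 h.contDiff_left i
    · exact contDiff_pi.1 h.contDiff_right j
  · intro h
    exact ⟨contDiff_pi.2 fun i => h.contDiff (Sum.inl i),
      contDiff_pi.2 fun j => h.contDiff (Sum.inr j),
      fun t ht => funext fun i => h.at_one t ht i, fun t ht => (hz t).2 (h.at_zero t ht)⟩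

theorem integral_dotProduct_eq_pairing {T : ℝ} {φ : ℝ → ℝ → Fin n → ℝ} {ψ : ℝ → ℝ → Fin m → ℝ}
    (h : S.IsTest T φ ψ) (a : L2 n) (b : L2 m) (t : ℝ) :
    ∫ x in (0 : ℝ)..1, ((a x).ofLp ⬝ᵥ φ t x + (b x).ofLp ⬝ᵥ ψ t x)
      = pairing (testCurve (components φ ψ) t) (toState (a, b)) := by
  have hF := S.isTest_iff.1 h
  rw [← integral_unitVol]
  refine Eq.trans ?_ (pairing_toL2s (fun k => continuous_section (hF.contDiff k).continuous t)
    (toState (a, b))).symm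
  refine integral_congr_ae ?_
  filter_upwards [ae_all_iff.2 (toState_inl_ae (a, b)), ae_all_iff.2 (toState_inr_ae (a, b))]
    with x h1 h2
  rw [Fintype.sum_sum_type]
  simp only [h1, h2]
  rfl

/-- The components of the right-hand side `source`, for profiles with integrable products. -/
theorem source_apply {a : ℝ → Fin n → ℝ} {b : ℝ → Fin m → ℝ} {u : Fin n ⊕ Fin m → ℝ → ℝ}
    {x : ℝ} (hx : 0 ≤ x) (hax : ∀ l, a x l = u (Sum.inl l) x) (hbx : ∀ l, b x l = u (Sum.inr l) x)
    (ha : ∀ᵐ ξ ∂volume.restrict (Ioc 0 x), ∀ l, a ξ l = u (Sum.inl l) ξ)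
    (hb : ∀ᵐ ξ ∂volume.restrict (Ioc 0 x), ∀ l, b ξ l = u (Sum.inr l) ξ)
    (hp : ∀ i l, IntervalIntegrable (fun ξ => S.Cp x ξ i l * u (Sum.inl l) ξ) volume 0 x)
    (hm : ∀ i l, IntervalIntegrable (fun ξ => S.Cm x ξ i l * u (Sum.inr l) ξ) volume 0 x)
    (i : Fin n) :
    S.source a b x i = ∑ l, S.Spp i l * u (Sum.inl l) x + ∑ j, S.Spm i j * u (Sum.inr j) x
      + ∑ l, (∫ ξ in (0 : ℝ)..x, S.Cp x ξ i l * u (Sum.inl l) ξ)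
      + ∑ j, ∫ ξ in (0 : ℝ)..x, S.Cm x ξ i j * u (Sum.inr j) ξ := by
  have key : ∀ {k : ℕ} (C : ℝ → Matrix (Fin n) (Fin k) ℝ) (c : ℝ → Fin k → ℝ) (v : Fin k → ℝ → ℝ),
      (∀ᵐ ξ ∂volume.restrict (Ioc 0 x), ∀ l, c ξ l = v l ξ) →
      (∀ i l, IntervalIntegrable (fun ξ => C ξ i l * v l ξ) volume 0 x) →
      (∫ ξ in (0 : ℝ)..x, C ξ *ᵥ c ξ) i = ∑ l, ∫ ξ in (0 : ℝ)..x, C ξ i l * v l ξ := by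
    intro k C c v hc hi
    have hsum : ∀ i, IntervalIntegrable (fun ξ => ∑ l, C ξ i l * v l ξ) volume 0 x := fun i => by
      have := IntervalIntegrable.sum Finset.univ fun l _ => hi i l
      refine this.congr (fun ξ _ => ?_)
      simp
    have hae : ∀ i, (fun ξ => (C ξ *ᵥ c ξ) i) =ᵐ[volume.restrict (Ioc 0 x)]
        fun ξ => ∑ l, C ξ i l * v l ξ := fun i => by
      filter_upwards [hc] with ξ h1
      simp only [Matrix.mulVec, dotProduct, h1]
    rw [intervalIntegral.integral_of_le hx, eval_integral fun i' => ?_, integral_congr_ae (hae i),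
      ← intervalIntegral.integral_of_le hx, intervalIntegral.integral_finsetSum fun l _ => hi i l]
    exact (((intervalIntegrable_iff_integrableOn_Ioc_of_le hx).1 (hsum i')).congr (hae i').symm)
  rw [source, Pi.add_apply, Pi.add_apply, Pi.add_apply, key (S.Cp x) a (fun l => u (Sum.inl l)) ha hp,
    key (S.Cm x) b (fun l => u (Sum.inr l)) hb hm]
  simp only [Matrix.mulVec, dotProduct, hax, hbx]

theorem integral_rhs_eq_pairing {B : State n m →L[ℝ] State n m} (hB : S.IsSourceOp B) {T : ℝ}
    {φ : ℝ → ℝ → Fin n → ℝ} {ψ : ℝ → ℝ → Fin m → ℝ} (h : S.IsTest T φ ψ) (a : L2 n) (b : L2 m)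
    (t : ℝ) :
    (∫ x in (0 : ℝ)..1,
        ((a x).ofLp ⬝ᵥ (deriv (fun s => φ s x) t + S.LamP *ᵥ deriv (fun y => φ t y) x)
          + (b x).ofLp ⬝ᵥ (deriv (fun s => ψ s x) t - S.LamM *ᵥ deriv (fun y => ψ t y) x)
          + S.source (fun y => (a y).ofLp) (fun y => (b y).ofLp) x ⬝ᵥ φ t x
          + (S.Om x *ᵥ (b x).ofLp) ⬝ᵥ ψ t x))
      = pairing (S.adjointCurve (components φ ψ) t) (toState (a, b))
        + pairing (testCurve (components φ ψ) t) (B (toState (a, b))) := by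
  have hF := S.isTest_iff.1 h
  have hc1 : ∀ k, Continuous (components φ ψ k t) := fun k =>
    continuous_section (hF.contDiff k).continuous t
  have hc2 : ∀ k, Continuous (transportDeriv (S.speed k) (components φ ψ k) t) := fun k =>
    continuous_section (continuous_transportDeriv (hF.contDiff k) _) t
  rw [← integral_unitVol]
  refine Eq.trans ?_ (congrArg₂ (· + ·) (pairing_toL2s hc2 (toState (a, b)))
    (pairing_toL2s hc1 (B (toState (a, b))))).symm
  rw [← integral_add (integrable_finsetSum _ fun k _ => integrable_mul_continuous _ (hc2 k))
    (integrable_finsetSum _ fun k _ => integrable_mul_continuous _ (hc1 k))]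
  have hl := ae_all_iff.2 (toState_inl_ae (a, b))
  have hr := ae_all_iff.2 (toState_inr_ae (a, b))
  refine integral_congr_ae ?_
  filter_upwards [hl, hr, hB (toState (a, b)), ae_restrict_mem measurableSet_Icc]
    with x h1 h2 h3 hx
  have hsub : volume.restrict (Ioc 0 x) ≤ unitVol :=
    Measure.restrict_mono (Ioc_subset_Icc_self.trans (Icc_subset_Icc_right hx.2)) le_rfl
  have hs : ∀ i, S.source (fun y => (a y).ofLp) (fun y => (b y).ofLp) x i
      = B (toState (a, b)) (Sum.inl i) x := fun i => by
    rw [h3.2.2.1 i]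
    refine S.source_apply (u := fun k ξ => toState (a, b) k ξ) hx.1 (fun l => (h1 l).symm)
      (fun l => (h2 l).symm) ?_ ?_ h3.1 h3.2.1 i
    · filter_upwards [ae_mono hsub hl] with ξ h4 l
      exact (h4 l).symm
    · filter_upwards [ae_mono hsub hr] with ξ h4 l
      exact (h4 l).symm
  have ho : ∀ j, (S.Om x *ᵥ (b x).ofLp) j = B (toState (a, b)) (Sum.inr j) x := fun j => by
    rw [h3.2.2.2 j]
    simp only [Matrix.mulVec, dotProduct, h2]
  have d1 : ∀ i, (deriv (fun s => φ s x) t + S.LamP *ᵥ deriv (fun y => φ t y) x) i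
      = transportDeriv (S.speed (Sum.inl i)) (components φ ψ (Sum.inl i)) t x := fun i => by
    rw [Pi.add_apply, LamP, Matrix.mulVec_diagonal,
      deriv_pi (φ := fun s => φ s x) fun i =>
        (hasDerivAt_uncurry_left (hF.contDiff (Sum.inl i)) t x).differentiableAt,
      deriv_pi (φ := fun y => φ t y) fun i =>
        (hasDerivAt_uncurry_right (hF.contDiff (Sum.inl i)) t x).differentiableAt]
    rfl
  have d2 : ∀ j, (deriv (fun s => ψ s x) t - S.LamM *ᵥ deriv (fun y => ψ t y) x) j
      = transportDeriv (S.speed (Sum.inr j)) (components φ ψ (Sum.inr j)) t x := fun j => by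
    rw [Pi.sub_apply, LamM, Matrix.mulVec_diagonal,
      deriv_pi (φ := fun s => ψ s x) fun j =>
        (hasDerivAt_uncurry_left (hF.contDiff (Sum.inr j)) t x).differentiableAt,
      deriv_pi (φ := fun y => ψ t y) fun j =>
        (hasDerivAt_uncurry_right (hF.contDiff (Sum.inr j)) t x).differentiableAt,
      sub_eq_add_neg, ← neg_mul]
    rfl
  rw [Fintype.sum_sum_type, Fintype.sum_sum_type]
  simp only [dotProduct, d1, d2, hs, ho, h1, h2]
  simp only [components]
  ring

/-- Weak solutions in terms of the state: the weak identity says that the curve of states is a weak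
solution of `w' = A w + B w`, where `A` generates the free transport. -/
theorem isWeakSolution_iff {B : State n m →L[ℝ] State n m} (hB : S.IsSourceOp B) {α₀ : L2 n}
    {β₀ : L2 m} {α : ℝ → L2 n} {β : ℝ → L2 m} :
    S.IsWeakSolution α₀ β₀ α β ↔ ContinuousOn α (Ici 0) ∧ ContinuousOn β (Ici 0) ∧
      ∀ T, 0 ≤ T → ∀ F, S.IsScalarTest T F →
        pairing (testCurve F T) (toState (α T, β T))
          = pairing (testCurve F 0) (toState (α₀, β₀))
            + ∫ t in (0 : ℝ)..T, (pairing (S.adjointCurve F t) (toState (α t, β t))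
              + pairing (testCurve F t) (B (toState (α t, β t)))) := by
  constructor
  · refine fun h => ⟨h.1, h.2, fun T hT F hF => ?_⟩
    obtain ⟨φ, ψ, rfl⟩ : ∃ (φ : ℝ → ℝ → Fin n → ℝ) (ψ : ℝ → ℝ → Fin m → ℝ), F = components φ ψ := by
      refine ⟨fun t x i => F (Sum.inl i) t x, fun t x j => F (Sum.inr j) t x, ?_⟩
      funext k t x
      rcases k with i | j <;> rfl
    have ht := S.isTest_iff.2 hF
    have h1 := h.identity T hT φ ψ ht
    simp_rw [S.integral_dotProduct_eq_pairing ht, S.integral_rhs_eq_pairing hB ht] at h1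
    exact h1
  · refine fun h => ⟨h.1, h.2.1, fun T hT φ ψ ht => ?_⟩
    simp_rw [S.integral_dotProduct_eq_pairing ht, S.integral_rhs_eq_pairing hB ht]
    exact h.2.2 T hT _ (S.isTest_iff.1 ht)

/-! ### Weak solutions are mild solutions -/

/-- A weak solution satisfies Duhamel's formula: the right-hand side of the formula is a weak
solution with the same source, and the difference solves the free transport with zero data. -/
theorem mild_of_weak {B : State n m →L[ℝ] State n m} {w : ℝ → State n m} (hw : Continuous w)
    {w₀ : State n m}
    (h : ∀ T, 0 ≤ T → ∀ F, S.IsScalarTest T F →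
      pairing (testCurve F T) (w T) = pairing (testCurve F 0) w₀
        + ∫ t in (0 : ℝ)..T, (pairing (S.adjointCurve F t) (w t)
          + pairing (testCurve F t) (B (w t)))) {T : ℝ} (hT : 0 ≤ T) :
    w T = S.transport T w₀ + ∫ s in (0 : ℝ)..T, S.transport (T - s) (B (w s)) := by
  set v : ℝ → State n m := fun t =>
    S.transport t w₀ + ∫ s in (0 : ℝ)..t, S.transport (t - s) (B (w s)) with hv
  have hf : Continuous fun t => B (w t) := B.continuous.comp hw
  have hvc : Continuous v := by
    have h1 : Continuous fun t => S.transport t w₀ := by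
      have h0 := S.continuous_transport.comp
        (continuous_id.prodMk (continuous_const (y := w₀)))
      exact h0
    have h2 : Continuous (Function.uncurry fun t s => S.transport (t - s) (B (w s))) := by
      have h0 := S.continuous_transport.comp
        ((continuous_fst.sub continuous_snd).prodMk (hf.comp continuous_snd))
      exact h0
    exact h1.add
      (intervalIntegral.continuous_parametric_intervalIntegral_of_continuous h2 continuous_id)
  have hz := S.eq_zero_of_weak (T := T) (d := fun t => w t - v t) fun F hF => by
    have e1 := h T hT F hF
    have e2 := weak_of_duhamel S.continuous_transport continuous_pairing hF.continuous_testCurve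
      hF.continuous_adjointCurve hT (fun s hs hsT f => S.transport_weak hF hs hsT f) hf
      (w := v) (w₀ := w₀) fun t _ => rfl
    have c1 : ∀ u : ℝ → State n m, Continuous u → Continuous fun t =>
        pairing (S.adjointCurve F t) (u t) := fun u hu => by
      have h0 := continuous_pairing.comp (hF.continuous_adjointCurve.prodMk hu)
      exact h0
    have c2 : Continuous fun t => pairing (testCurve F t) (B (w t)) := by
      have h0 := continuous_pairing.comp (hF.continuous_testCurve.prodMk hf)
      exact h0
    rw [intervalIntegral.integral_add ((c1 w hw).intervalIntegrable _ _)
      (c2.intervalIntegrable _ _)] at e1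
    rw [intervalIntegral.integral_add ((c1 v hvc).intervalIntegrable _ _)
      (c2.intervalIntegrable _ _)] at e2
    simp only [map_sub]
    rw [intervalIntegral.integral_sub ((c1 w hw).intervalIntegrable _ _)
      ((c1 v hvc).intervalIntegrable _ _), e1, e2]
    ring
  exact sub_eq_zero.1 hz

theorem exists_isWeakSolution {B : State n m →L[ℝ] State n m} (hB : S.IsSourceOp B) (α₀ : L2 n)
    (β₀ : L2 m) : ∃ (α : ℝ → L2 n) (β : ℝ → L2 m), S.IsWeakSolution α₀ β₀ α β := by
  obtain ⟨w, hw, hmild⟩ := exists_mild S.continuous_transport S.norm_transport_le B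
    (toState (α₀, β₀))
  have hc : Continuous fun t => (ofState (w t) : L2 n × L2 m) := ofState.continuous.comp hw
  refine ⟨fun t => (ofState (w t)).1, fun t => (ofState (w t)).2, (S.isWeakSolution_iff hB).2
    ⟨hc.fst.continuousOn, hc.snd.continuousOn, fun T hT F hF => ?_⟩⟩
  simp only [Prod.mk.eta, toState_ofState]
  exact weak_of_duhamel S.continuous_transport continuous_pairing hF.continuous_testCurve
    hF.continuous_adjointCurve hT (fun s hs hsT f => S.transport_weak hF hs hsT f)
    (B.continuous.comp hw) hmild

end TargetSystem

end HyperbolicTarget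

end

theorem lemma1 (n m : ℕ) (S : HyperbolicTarget.TargetSystem n m) :
    ∃ K κ : ℝ, 0 < K ∧ 0 < κ ∧
      ∀ (α₀ : HyperbolicTarget.L2 n) (β₀ : HyperbolicTarget.L2 m),
        (∃ (α : ℝ → HyperbolicTarget.L2 n) (β : ℝ → HyperbolicTarget.L2 m),
          S.IsWeakSolution α₀ β₀ α β) ∧
        ∀ (α : ℝ → HyperbolicTarget.L2 n) (β : ℝ → HyperbolicTarget.L2 m),
          S.IsWeakSolution α₀ β₀ α β →
            ∀ t : ℝ, 0 ≤ t →
              HyperbolicTarget.l2Norm (α t) (β t)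
                ≤ K * Real.exp (-κ * t) * HyperbolicTarget.l2Norm α₀ β₀ := by
  open HyperbolicTarget in
  obtain ⟨B, hB, b, hb, hBw⟩ := S.exists_sourceOp
  obtain ⟨c, hc, hl, hm⟩ := S.exists_speed_lower_bound
  set M := S.transportBound
  have hM : 0 ≤ M := S.transportBound_nonneg
  -- with this weight the free transport decays at the rate `2Mb + 2`; the right-hand side may
  -- consume `2Mb` of it, and what is left exceeds `κ = 1`
  set ν : ℝ := (2 * (M * b) + 2) / c with hν
  have hν0 : 0 ≤ ν := by positivity
  have hνc : ν * c = 2 * (M * b) + 2 := div_mul_cancel₀ _ hc.ne'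
  set k₁ : ℝ := 2 * ‖(ofState : State n m →L[ℝ] L2 n × L2 m)‖ * Real.exp ν with hk₁
  set k₂ : ℝ := ‖(weightOp ν : State n m →L[ℝ] State n m)‖
    * ‖(toState : L2 n × L2 m →L[ℝ] State n m)‖ with hk₂
  refine ⟨k₁ * (2 * M) * k₂ + 1, 1, by positivity, one_pos, fun α₀ β₀ =>
    ⟨S.exists_isWeakSolution hB α₀ β₀, fun α β hαβ t ht => ?_⟩⟩
  obtain ⟨hα, hβ, hid⟩ := (S.isWeakSolution_iff hB).1 hαβ
  have hmax : ∀ s : ℝ, max s 0 ∈ Set.Ici (0 : ℝ) := fun s => le_max_right s 0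
  have hmc : Continuous fun s : ℝ => max s 0 := continuous_id.max continuous_const
  -- the curve of states, extended to negative times as a constant
  set w : ℝ → State n m := fun s => toState (α (max s 0), β (max s 0)) with hw
  have hwc : Continuous w :=
    toState.continuous.comp ((hα.comp_continuous hmc hmax).prodMk (hβ.comp_continuous hmc hmax))
  have hws : ∀ s, 0 ≤ s → w s = toState (α s, β s) := fun s hs => by simp only [hw, max_eq_left hs]
  have hmild : ∀ T, 0 ≤ T → w T = S.transport T (toState (α₀, β₀))
      + ∫ s in (0 : ℝ)..T, S.transport (T - s) (B (w s)) := fun T hT => by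
    refine S.mild_of_weak hwc (fun T hT F hF => ?_) hT
    rw [hws T hT, hid T hT F hF]
    congr 1
    refine intervalIntegral.integral_congr fun s hs => ?_
    rw [Set.uIcc_of_le hT] at hs
    simp only [hws s hs.1]
  have hdec := mild_decay S.continuous_transport (W := weightOp ν) (K := M) (b := b) (δ := ν * c)
    (κ := 1) hM hb (by rw [hνc]; nlinarith [mul_nonneg hM hb]) (by rw [hνc]; linarith)
    (fun t ht f => S.norm_weightOp_transport_le hl hm hν0 ht f) (hBw ν hν0) hwc hmild ht
  have hN : 0 ≤ l2Norm α₀ β₀ := Real.sqrt_nonneg _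
  have h0 : ‖weightOp ν (toState (α₀, β₀))‖ ≤ k₂ * l2Norm α₀ β₀ := by
    rw [hk₂, mul_assoc]
    exact (ContinuousLinearMap.le_opNorm _ _).trans
      (mul_le_mul_of_nonneg_left (norm_toState_le (α₀, β₀)) (norm_nonneg _))
  calc l2Norm (α t) (β t)
      ≤ 2 * ‖(ofState : State n m →L[ℝ] L2 n × L2 m)‖ * ‖w t‖ := by
        rw [hws t ht]; exact l2Norm_le (α t, β t)
    _ ≤ k₁ * ‖weightOp ν (w t)‖ := by
        rw [hk₁, mul_assoc _ (Real.exp ν)]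
        gcongr
        exact norm_le_norm_weightOp hν0 _
    _ ≤ k₁ * (2 * M * Real.exp (-1 * t) * (k₂ * l2Norm α₀ β₀)) := by
        gcongr
        exact hdec.trans (by gcongr)
    _ = (k₁ * (2 * M) * k₂) * Real.exp (-1 * t) * l2Norm α₀ β₀ := by ring
    _ ≤ (k₁ * (2 * M) * k₂ + 1) * Real.exp (-1 * t) * l2Norm α₀ β₀ := by
        gcongr
        linarith
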